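/- Let $\mathcal X$ and $\mathcal A$ be finite sets, and let $M=(\mathcal X,\mathcal A,P,r)$ be a Markov decision process with transition probabilities $P(x';x,a)$ and mean rewards $r(x,a)$. An agent that does not know $M$ interacts with it: at each time $k=0,1,2,\dots$ it observes the state $X_k$, chooses an action $A_k$ by an arbitrary non-anticipating (possibly randomized) rule, and receives a random reward $R_k\in[0,1]$. Conditionally on the information available once $A_k$ has been chosen, $R_k$ has mean $r(X_k,A_k)$ and $X_{k+1}$ has law $P(\cdot\,;X_k,A_k)$. For $t\ge 0$ put $$N_t(x,a)=\sum_{k=0}^{t-1}\mathbf 1_{\{X_k=x,\,A_k=a\}},\qquad N_t(x,a,x')=\sum_{k=0}^{t-1}\mathbf 1_{\{X_k=x,\,A_k=a,\,X_{k+1}=x'\}},$$ $$\hat P_t(x';x,a)=\frac{N_t(x,a,x')}{\max(N_t(x,a),1)},\qquad \hat r_t(x,a)=\frac{\sum_{k=0}^{t-1}R_k\mathbf 1_{\{X_k=x,\,A_k=a\}}}{\max(N_t(x,a),1)}.$$ Let $KL(p,q)=\sum_i p_i\log(p_i/q_i)$, with $0\log 0=0$ and $KL(p,q)=+\infty$ if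 $q_i=0<p_i$ for some $i$. Given a horizon $T$ and $\delta>0$, put $$B=\log\frac{2e|\mathcal X|^2|\mathcal A|\log T}{\delta},\qquad C_P=|\mathcal X|\left(B+\log\Big(B+\frac1{\log T}\Big)\Big[1+\frac{1}{B+\frac1{\log T}}\Big]\right),\qquad C_R=\sqrt{\frac{\log(4|\mathcal X||\mathcal A|\log T/\delta)}{1.99}},$$ and let $\mathcal M_t$ be the (random) set of all MDPs $(\mathcal X,\mathcal A,P',r')$ such that for all $x\in\mathcal X$ and $a\in\mathcal A$ $$|\hat r_t(x,a)-r'(x,a)|\le\frac{C_R}{\sqrt{N_t(x,a)}}\quad\text{and}\quad KL\big(\hat P_t(\cdot\,;x,a),P'(\cdot\,;x,a)\big)\le\frac{C_P}{N_t(x,a)},$$ where the right-hand sides are $+\infty$ if $N_t(x,a)=0$. Then, for every horizon $T\ge 2$ and every $\delta>0$, $$\mathbb P\big(\forall t\le T,\ M\in\mathcal M_t\big)\ \ge\ 1-2\delta .$$ (For $\delta\ge 1/2$ the claim is trivial; for $\delta<1/2$ and $T\ge2$ all the constants above are well defined.) -/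

import Mathlib

open MeasureTheory

namespace KLUCRL

/-- A Markov decision process with finite state space `X` and action space `A`:
`trans x a y` is the probability of jumping from `x` to `y` under action `a`, and
`reward x a` is the mean reward of the pair `(x, a)`. -/
structure MDP (X A : Type*) [Fintype X] where
  trans : X → A → X → ℝ
  reward : X → A → ℝ
  trans_nonneg : ∀ x a y, 0 ≤ trans x a y
  trans_sum : ∀ x a, ∑ y, trans x a y = 1

/-- The processes `S` (states), `U` (actions) and `R` (rewards) describe an agent interacting with
the MDP `M`. Here `ℱ k` is the information available once the action of time `k` has been chosen;
the agent may use any non-anticipating, possibly randomized, rule. Given `ℱ k`, the next state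
has law `M.trans (S k) (U k)`, and the reward, which lies in `[0, 1]`, has mean
`M.reward (S k) (U k)`. -/
structure IsTrajectory {Ω X A : Type*} [Fintype X] {m : MeasurableSpace Ω}
    (M : MDP X A) (μ : Measure Ω) (ℱ : Filtration ℕ m)
    (S : ℕ → Ω → X) (U : ℕ → Ω → A) (R : ℕ → Ω → ℝ) : Prop where
  state_meas : ∀ k x, MeasurableSet[ℱ k] {ω | S k ω = x}
  action_meas : ∀ k a, MeasurableSet[ℱ k] {ω | U k ω = a}
  reward_meas : ∀ k, Measurable[ℱ (k + 1)] (R k)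
  reward_mem : ∀ k, ∀ᵐ ω ∂μ, R k ω ∈ Set.Icc (0 : ℝ) 1
  state_law : ∀ k y,
    μ[Set.indicator {ω | S (k + 1) ω = y} (fun _ => (1 : ℝ)) | ℱ k]
      =ᵐ[μ] fun ω => M.trans (S k ω) (U k ω) y
  reward_mean : ∀ k, μ[R k | ℱ k] =ᵐ[μ] fun ω => M.reward (S k ω) (U k ω)

section Estimates

variable {X A : Type*} [DecidableEq X] [DecidableEq A]

/-- `N_t(x, a)`: number of visits to `(x, a)` strictly before time `t`,
along a path `s` of states and `u` of actions. -/
def visits (s : ℕ → X) (u : ℕ → A) (t : ℕ) (x : X) (a : A) : ℕ :=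
  ((Finset.range t).filter (fun k => s k = x ∧ u k = a)).card

/-- `N_t(x, a, y)`: number of those visits that are followed by state `y`. -/
def visitsTo (s : ℕ → X) (u : ℕ → A) (t : ℕ) (x : X) (a : A) (y : X) : ℕ :=
  ((Finset.range t).filter (fun k => s k = x ∧ u k = a ∧ s (k + 1) = y)).card

/-- Estimated transition probabilities at time `t`. -/
noncomputable def estTrans (s : ℕ → X) (u : ℕ → A) (t : ℕ) (x : X) (a : A) (y : X) : ℝ :=
  (visitsTo s u t x a y : ℝ) / max (visits s u t x a : ℝ) 1

/-- Estimated mean reward at time `t`. -/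
noncomputable def estReward (s : ℕ → X) (u : ℕ → A) (r : ℕ → ℝ) (t : ℕ) (x : X) (a : A) : ℝ :=
  (∑ k ∈ Finset.range t, if s k = x ∧ u k = a then r k else 0) / max (visits s u t x a : ℝ) 1

end Estimates

open Classical in
/-- Kullback–Leibler divergence `∑ i, p i * log (p i / q i)` of probability vectors, with
`0 * log 0 = 0`, and the value `+∞` when `q i = 0 < p i` for some `i`. -/
noncomputable def klVec {X : Type*} [Fintype X] (p q : X → ℝ) : EReal :=
  if ∃ i, p i ≠ 0 ∧ q i = 0 then ⊤
  else ((∑ i, p i * Real.log (p i / q i) : ℝ) : EReal)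

/-- Radius `C / N` of a transition neighborhood; `+∞` if there are no observations. -/
noncomputable def radiusP (C : ℝ) (N : ℕ) : EReal :=
  if N = 0 then ⊤ else ((C / N : ℝ) : EReal)

/-- Radius `C / √N` of a reward neighborhood; `+∞` if there are no observations. -/
noncomputable def radiusR (C : ℝ) (N : ℕ) : EReal :=
  if N = 0 then ⊤ else ((C / Real.sqrt N : ℝ) : EReal)

/-- The set of plausible MDPs at time `t`, along a path of states `s`, actions `u`, rewards `r`. -/
def confidenceSet {X A : Type*} [Fintype X] [DecidableEq X] [DecidableEq A]
    (CP CR : ℝ) (s : ℕ → X) (u : ℕ → A) (r : ℕ → ℝ) (t : ℕ) : Set (MDP X A) :=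
  {M | ∀ x a,
    ((|estReward s u r t x a - M.reward x a| : ℝ) : EReal) ≤ radiusR CR (visits s u t x a) ∧
    klVec (estTrans s u t x a) (M.trans x a) ≤ radiusP CP (visits s u t x a)}

/-- `B = log (2 e |X|² |A| log T / δ)`. -/
noncomputable def constB (nX nA T : ℕ) (δ : ℝ) : ℝ :=
  Real.log (2 * Real.exp 1 * (nX : ℝ) ^ 2 * nA * Real.log T / δ)

/-- `C_P = |X| (B + log (B + 1 / log T) (1 + 1 / (B + 1 / log T)))`. -/
noncomputable def constP (nX nA T : ℕ) (δ : ℝ) : ℝ :=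
  nX * (constB nX nA T δ +
    Real.log (constB nX nA T δ + 1 / Real.log T) *
      (1 + 1 / (constB nX nA T δ + 1 / Real.log T)))

/-- `C_R = √(log (4 |X| |A| log T / δ) / 1.99)`. -/
noncomputable def constR (nX nA T : ℕ) (δ : ℝ) : ℝ :=
  Real.sqrt (Real.log (4 * nX * nA * Real.log T / δ) / 1.99)

end KLUCRL

/-!
The estimates of one state-action pair are governed by a single kind of process: on each visit an
observation `Y ∈ [0, 1]` with conditional mean `p` is recorded (`IsSampling`). With `N` the number
of visits and `Q` the sum of the observations, `exp (l * Q - φ * N)` is a supermartingale as soon as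
`1 + p * (exp l - 1) ≤ exp φ`. Stopping it at the first bad time and integrating over `l` against a
measure `ν` gives a maximal inequality (`IsSampling.measure_exists_le_of_mixture`): if the mixture
is at least `1` whenever the bad event occurs, that event has probability at most the mass of `ν`.

*Transitions.* When `p` and `q` are probability vectors, `∑ p log (p / q)` is the sum over
coordinates of the Poisson divergences `z log (z / p) - z + p`, so it suffices to control each
coordinate, for which `φ = p * (exp l - 1)` is admissible. The range `[1, T]` of `N` is cut into
geometric slices of ratio `ε / (ε - 1)`; one tilt `l` per slice and per side gives a failure
probability of at most `2 * ((ε - 2 / 5) * log T + 1) * exp (1 - ε)`, and with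
`ε = C_P / |X|` this is at most `δ / (|X|² |A|)`.

*Rewards.* Here `φ = l * p + l ^ 2 / 8` (Hoeffding), and the event is `Q - p * N > C * √N`; each
side must have probability at most `2 * log T * exp (-1.99 * C ^ 2)`. Slicing achieves this for
`C ^ 2 ≤ 4`, but loses too large a constant for moderately large `C`. For `C ^ 2 ≥ 4` the tilts are
mixed with density proportional to `1 / l`. With `g ^ 2 = 2 * C ^ 2` the exponent at
`l = (1 + v) * 4 * C / √N` is at least `g ^ 2 * (1 - v ^ 2)`, and integrating over `|v| ≤ 6 / (5 g)`
recovers nearly the whole Gaussian integral. Only `log T / 2` enters the mass of the mixture, and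
`g * exp (-0.005 * g ^ 2)` is bounded, which gives the required constant
(`mixture_mass_le`, `one_le_setLIntegral_window`). An event of this kind forces `N > C ^ 2`, and this
pays for the two ends of the range of tilts.

A union bound over the pairs and coordinates spends `δ` on the rewards and `δ` on the transitions.
-/

/-! ### Exponential supermartingales and a mixture maximal inequality -/

namespace KLUCRL

section Sampling

variable {Ω : Type*} {m : MeasurableSpace Ω}

/-- A sampling scheme: at time `k` an observation `Y k ∈ [0, 1]` is recorded on the event `D k`, which
is known at time `k`, and on `D k` the conditional mean of `Y k` is `p`. The observation is only
revealed at time `k + 1`. -/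
structure IsSampling (μ : Measure Ω) (ℱ : Filtration ℕ m) (D : ℕ → Set Ω) (Y : ℕ → Ω → ℝ)
    (p : ℝ) : Prop where
  meas_visit : ∀ k, MeasurableSet[ℱ k] (D k)
  meas_obs : ∀ k, Measurable[ℱ (k + 1)] (Y k)
  obs_mem : ∀ k, ∀ᵐ ω ∂μ, Y k ω ∈ Set.Icc (0 : ℝ) 1
  mean : ∀ k, ∀ᵐ ω ∂μ, ω ∈ D k → (μ[Y k | ℱ k]) ω = p

/-- The number of times `k < t` at which an observation is recorded, as a real number. -/
noncomputable def visitCount (D : ℕ → Set Ω) (t : ℕ) (ω : Ω) : ℝ :=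
  ∑ k ∈ Finset.range t, (D k).indicator (fun _ => (1 : ℝ)) ω

/-- The sum of the observations recorded strictly before time `t`. -/
noncomputable def visitSum (D : ℕ → Set Ω) (Y : ℕ → Ω → ℝ) (t : ℕ) (ω : Ω) : ℝ :=
  ∑ k ∈ Finset.range t, (D k).indicator (Y k) ω

/-- The exponential process with tilt `l` and compensator `φ` per recorded observation. -/
noncomputable def tiltedExp (D : ℕ → Set Ω) (Y : ℕ → Ω → ℝ) (l φ : ℝ) (t : ℕ) (ω : Ω) : ℝ :=
  Real.exp (l * visitSum D Y t ω - φ * visitCount D t ω)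

variable {μ : Measure Ω} {ℱ : Filtration ℕ m} {D : ℕ → Set Ω} {Y : ℕ → Ω → ℝ} {p : ℝ}

lemma IsSampling.measurable_visitCount (h : IsSampling μ ℱ D Y p) (t : ℕ) :
    Measurable[ℱ t] (visitCount D t) := by
  refine Finset.measurable_fun_sum _ fun k hk => ?_
  refine Measurable.indicator measurable_const ?_
  exact ℱ.mono (Finset.mem_range.1 hk).le _ (h.meas_visit k)

lemma IsSampling.measurable_visitSum (h : IsSampling μ ℱ D Y p) (t : ℕ) :
    Measurable[ℱ t] (visitSum D Y t) := by
  refine Finset.measurable_fun_sum _ fun k hk => ?_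
  have hk := Finset.mem_range.1 hk
  refine Measurable.indicator ((h.meas_obs k).mono (ℱ.mono hk) le_rfl) ?_
  exact ℱ.mono hk.le _ (h.meas_visit k)

lemma IsSampling.measurable_tiltedExp (h : IsSampling μ ℱ D Y p) (l φ : ℝ) (t : ℕ) :
    Measurable[ℱ t] (tiltedExp D Y l φ t) :=
  Real.measurable_exp.comp (((h.measurable_visitSum t).const_mul l).sub
    ((h.measurable_visitCount t).const_mul φ))

lemma visitCount_nonneg (D : ℕ → Set Ω) (t : ℕ) (ω : Ω) : 0 ≤ visitCount D t ω :=
  Finset.sum_nonneg fun _ _ => Set.indicator_nonneg (fun _ _ => zero_le_one) _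

lemma visitCount_le (D : ℕ → Set Ω) (t : ℕ) (ω : Ω) : visitCount D t ω ≤ t := by
  refine (Finset.sum_le_card_nsmul _ _ 1 fun k _ => ?_).trans (by simp)
  exact Set.indicator_le_self' (fun _ _ => zero_le_one) ω

lemma IsSampling.ae_visitSum_mem (h : IsSampling μ ℱ D Y p) :
    ∀ᵐ ω ∂μ, ∀ t, visitSum D Y t ω ∈ Set.Icc 0 (visitCount D t ω) := by
  filter_upwards [ae_all_iff.2 h.obs_mem] with ω hω t
  refine ⟨Finset.sum_nonneg fun k _ => ?_, Finset.sum_le_sum fun k _ => ?_⟩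
  · by_cases hk : ω ∈ D k <;> simp [hk, (hω k).1]
  · by_cases hk : ω ∈ D k <;> simp [hk, (hω k).2]

lemma IsSampling.integrable_tiltedExp [IsProbabilityMeasure μ] (h : IsSampling μ ℱ D Y p)
    (l φ : ℝ) (t : ℕ) : Integrable (tiltedExp D Y l φ t) μ := by
  refine Integrable.of_bound
    ((h.measurable_tiltedExp l φ t).mono (ℱ.le t) le_rfl).aestronglyMeasurable
    (Real.exp (|l| * t + |φ| * t)) ?_
  filter_upwards [h.ae_visitSum_mem] with ω hω
  rw [Real.norm_eq_abs, tiltedExp, Real.abs_exp, Real.exp_le_exp]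
  have hN := visitCount_le D t ω
  have h1 : l * visitSum D Y t ω ≤ |l| * t :=
    mul_le_mul (le_abs_self l) ((hω t).2.trans hN) (hω t).1 (abs_nonneg l)
  have h2 : -φ * visitCount D t ω ≤ |φ| * t :=
    mul_le_mul (neg_le_abs φ) hN (visitCount_nonneg D t ω) (abs_nonneg φ)
  linarith

lemma IsSampling.integrable_obs [IsProbabilityMeasure μ] (h : IsSampling μ ℱ D Y p) (k : ℕ) :
    Integrable (Y k) μ := by
  refine Integrable.of_bound ((h.meas_obs k).mono (ℱ.le _) le_rfl).aestronglyMeasurable 1 ?_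
  filter_upwards [h.obs_mem k] with ω hω
  rw [Real.norm_eq_abs, abs_le]
  exact ⟨by linarith [hω.1], hω.2⟩

/-- Under the integral, an observation may be replaced by its conditional mean `p` against any factor
that is known at time `k` and supported on `D k`. -/
lemma IsSampling.integral_mul_obs [IsProbabilityMeasure μ] (h : IsSampling μ ℱ D Y p) (k : ℕ)
    {f : Ω → ℝ} (hf : StronglyMeasurable[ℱ k] f) (hfi : Integrable f μ)
    (hD : ∀ ω, ω ∉ D k → f ω = 0) : ∫ ω, f ω * Y k ω ∂μ = ∫ ω, f ω * p ∂μ := by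
  have hfY : Integrable (f * Y k) μ := by
    refine hfi.mul_bdd (c := 1)
      ((h.meas_obs k).mono (ℱ.le _) le_rfl).aestronglyMeasurable ?_
    filter_upwards [h.obs_mem k] with ω hω
    rw [Real.norm_eq_abs, abs_le]
    exact ⟨by linarith [hω.1], hω.2⟩
  have h1 := condExp_mul_of_stronglyMeasurable_left hf hfY (h.integrable_obs k)
  have h2 : ∫ ω, (f * Y k) ω ∂μ = ∫ ω, (f * μ[Y k | ℱ k]) ω ∂μ := by
    rw [← integral_condExp (ℱ.le k)]
    exact integral_congr_ae h1
  refine h2.trans (integral_congr_ae ?_)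
  filter_upwards [h.mean k] with ω hω
  by_cases hk : ω ∈ D k
  · simp [hω hk]
  · simp [hD ω hk]

lemma tiltedExp_succ (l φ : ℝ) (t : ℕ) (ω : Ω) :
    tiltedExp D Y l φ (t + 1) ω = tiltedExp D Y l φ t ω *
      (D t).indicator (fun ω => Real.exp (l * Y t ω - φ)) ω +
      (D t)ᶜ.indicator (tiltedExp D Y l φ t) ω := by
  by_cases hk : ω ∈ D t
  · simp only [tiltedExp, visitSum, visitCount, Finset.sum_range_succ, hk,
      Set.indicator_of_mem, Set.mem_compl_iff, not_true, not_false_iff,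
      Set.indicator_of_notMem, add_zero, ← Real.exp_add]
    congr 1; ring
  · simp [tiltedExp, visitSum, visitCount, Finset.sum_range_succ, hk]

lemma exp_mul_le_of_mem_Icc (l : ℝ) {y : ℝ} (hy : y ∈ Set.Icc (0 : ℝ) 1) :
    Real.exp (l * y) ≤ 1 + y * (Real.exp l - 1) := by
  have := convexOn_exp.2 (Set.mem_univ (0 : ℝ)) (Set.mem_univ l) (sub_nonneg.2 hy.2) hy.1
    (by ring)
  simp only [smul_eq_mul, mul_zero, zero_add, Real.exp_zero, mul_one] at this
  rw [mul_comm l y]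
  linarith

/-- The supermartingale property: by convexity `exp (l * Y)` lies below an affine function of `Y`, whose
conditional mean is `1 + p * (exp l - 1)`. -/
lemma IsSampling.setIntegral_tiltedExp_succ_le [IsProbabilityMeasure μ]
    (h : IsSampling μ ℱ D Y p) {l φ : ℝ} (hφ : 1 + p * (Real.exp l - 1) ≤ Real.exp φ) (t : ℕ)
    {G : Set Ω} (hG : MeasurableSet[ℱ t] G) :
    ∫ ω in G, tiltedExp D Y l φ (t + 1) ω ∂μ ≤ ∫ ω in G, tiltedExp D Y l φ t ω ∂μ := by
  set V := tiltedExp D Y l φ t with hV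
  have hVi : Integrable V μ := h.integrable_tiltedExp l φ t
  have hVm : Measurable[ℱ t] V := h.measurable_tiltedExp l φ t
  have hGm := ℱ.le t _ hG
  have hDm := ℱ.le t _ (h.meas_visit t)
  set f : Ω → ℝ := (G ∩ D t).indicator V with hf
  have hfi : Integrable f μ := hVi.indicator (hGm.inter hDm)
  have hfm : StronglyMeasurable[ℱ t] f :=
    (hVm.indicator (hG.inter (h.meas_visit t))).stronglyMeasurable
  have hfY : Integrable (fun ω => f ω * Y t ω) μ := by
    refine hfi.mul_bdd (c := 1)
      ((h.meas_obs t).mono (ℱ.le _) le_rfl).aestronglyMeasurable ?_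
    filter_upwards [h.obs_mem t] with ω hω
    rw [Real.norm_eq_abs, abs_le]
    exact ⟨by linarith [hω.1], hω.2⟩
  have key := h.integral_mul_obs t hfm hfi (fun ω hω => by simp [hf, hω])
  have hf0 : 0 ≤ ∫ ω, f ω ∂μ :=
    integral_nonneg fun ω => Set.indicator_nonneg (fun _ _ => (Real.exp_pos _).le) _
  rw [← integral_indicator hGm, ← integral_indicator hGm]
  have step : ∀ᵐ ω ∂μ, G.indicator (tiltedExp D Y l φ (t + 1)) ω ≤
      G.indicator V ω + (Real.exp (-φ) - 1) * f ω +
        Real.exp (-φ) * (Real.exp l - 1) * (f ω * Y t ω) := by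
    filter_upwards [h.obs_mem t] with ω hω
    by_cases hg : ω ∈ G
    · by_cases hd : ω ∈ D t
      · have h1 := exp_mul_le_of_mem_Icc l hω
        have h2 : (0 : ℝ) < V ω := Real.exp_pos _
        have h3 : 0 < Real.exp (-φ) := Real.exp_pos _
        simp only [hg, hd, hf, Set.indicator_of_mem, tiltedExp_succ, Set.mem_inter_iff,
          and_self, Set.mem_compl_iff, not_true, not_false_iff, Set.indicator_of_notMem, ← hV,
          sub_eq_add_neg (l * Y t ω) φ, Real.exp_add]
        have := mul_le_mul_of_nonneg_left h1 (mul_pos h2 h3).le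
        linarith
      · simp [hg, hd, hf, tiltedExp_succ, ← hV]
    · simp [hg, hf]
  have hint := ((hVi.indicator hGm).add (hfi.const_mul (Real.exp (-φ) - 1))).add
    (hfY.const_mul (Real.exp (-φ) * (Real.exp l - 1)))
  refine (integral_mono_ae ((h.integrable_tiltedExp l φ (t + 1)).indicator hGm) hint
    step).trans ?_
  simp only [Pi.add_apply]
  rw [integral_add (f := fun ω => G.indicator V ω + (Real.exp (-φ) - 1) * f ω)
      ((hVi.indicator hGm).add (hfi.const_mul _)) (hfY.const_mul _),
    integral_add (hVi.indicator hGm) (hfi.const_mul _), integral_const_mul, integral_const_mul,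
    key, integral_mul_const]
  have h4 : Real.exp (-φ) * (1 + p * (Real.exp l - 1)) ≤ 1 := by
    have := mul_le_mul_of_nonneg_left hφ (Real.exp_pos (-φ)).le
    rwa [← Real.exp_add, neg_add_cancel, Real.exp_zero] at this
  nlinarith [mul_le_mul_of_nonneg_right h4 hf0]

lemma IsSampling.setLIntegral_tiltedExp_succ_le [IsProbabilityMeasure μ]
    (h : IsSampling μ ℱ D Y p) {l φ : ℝ} (hφ : 1 + p * (Real.exp l - 1) ≤ Real.exp φ) (t : ℕ)
    {G : Set Ω} (hG : MeasurableSet[ℱ t] G) :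
    ∫⁻ ω in G, ENNReal.ofReal (tiltedExp D Y l φ (t + 1) ω) ∂μ ≤
      ∫⁻ ω in G, ENNReal.ofReal (tiltedExp D Y l φ t ω) ∂μ := by
  rw [← ofReal_integral_eq_lintegral_ofReal (h.integrable_tiltedExp l φ _).integrableOn
      (ae_of_all _ fun _ => (Real.exp_pos _).le),
    ← ofReal_integral_eq_lintegral_ofReal (h.integrable_tiltedExp l φ _).integrableOn
      (ae_of_all _ fun _ => (Real.exp_pos _).le)]
  exact ENNReal.ofReal_le_ofReal (h.setIntegral_tiltedExp_succ_le hφ t hG)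

/-- The event that `t` is the first time at which the path lies in `E t`. -/
def firstEntry (E : ℕ → Set Ω) (t : ℕ) : Set Ω := {ω | (∀ s < t, ω ∉ E s) ∧ ω ∈ E t}

lemma measurableSet_notEntered {E : ℕ → Set Ω} (hE : ∀ t, MeasurableSet[ℱ t] (E t)) (t : ℕ) :
    MeasurableSet[ℱ t] {ω | ∀ s < t, ω ∉ E s} := by
  simp only [Set.ofPred_forall]
  exact MeasurableSet.iInter fun s => MeasurableSet.iInter fun hs =>
    (ℱ.mono (le_of_lt hs) _ (hE s)).compl

/-- Optional stopping at the first entry into `E`, for a nonnegative supermartingale started at `1`. -/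
lemma sum_setLIntegral_firstEntry_le [IsProbabilityMeasure μ] {V : ℕ → Ω → ENNReal}
    (hV0 : ∀ ω, V 0 ω = 1)
    (hV : ∀ t G, MeasurableSet[ℱ t] G → ∫⁻ ω in G, V (t + 1) ω ∂μ ≤ ∫⁻ ω in G, V t ω ∂μ)
    {E : ℕ → Set Ω} (hE : ∀ t, MeasurableSet[ℱ t] (E t)) (T : ℕ) :
    ∑ t ∈ Finset.range T, ∫⁻ ω in firstEntry E t, V t ω ∂μ ≤ 1 := by
  -- The mass on the paths that have not entered yet makes the induction go through.
  suffices hs : ∑ t ∈ Finset.range T, ∫⁻ ω in firstEntry E t, V t ω ∂μ +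
      ∫⁻ ω in {ω | ∀ s < T, ω ∉ E s}, V T ω ∂μ ≤ 1 from le_self_add.trans hs
  induction T with
  | zero => simp [hV0]
  | succ T ih =>
    refine le_trans ?_ ih
    rw [Finset.sum_range_succ, add_assoc]
    gcongr
    have hm := measurableSet_notEntered hE T
    rw [← lintegral_inter_add_sdiff (μ := μ) (V T) {ω | ∀ s < T, ω ∉ E s} (ℱ.le T _ (hE T))]
    refine add_le_add le_rfl ?_
    · have : {ω | ∀ s < T + 1, ω ∉ E s} = {ω | ∀ s < T, ω ∉ E s} \ E T := by
        ext ω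
        simp only [Set.mem_ofPred_eq, Set.mem_sdiff, Nat.lt_succ_iff_lt_or_eq]
        constructor
        · exact fun H => ⟨fun s hs => H s (Or.inl hs), H T (Or.inr rfl)⟩
        · rintro ⟨H1, H2⟩ s (hs | rfl)
          exacts [H1 s hs, H2]
      rw [this]
      exact hV T _ (hm.diff (hE T))

lemma iUnion_subset_firstEntry (E : ℕ → Set Ω) (T : ℕ) :
    {ω | ∃ t < T, ω ∈ E t} ⊆ ⋃ t ∈ Finset.range T, firstEntry E t := by
  classical
  rintro ω ⟨t, ht, hω⟩
  have hex : ∃ t, ω ∈ E t := ⟨t, hω⟩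
  simp only [Set.mem_iUnion, Finset.mem_range]
  exact ⟨Nat.find hex, (Nat.find_min' hex hω).trans_lt ht, fun s hs => Nat.find_min hex hs,
    Nat.find_spec hex⟩

/-- Maximal inequality by mixtures: if the exponential processes, integrated over their tilt against
`ν`, are at least `1` on `E t` for every `t`, then some `E t` occurs with probability at most the
total mass of `ν`. -/
theorem IsSampling.measure_exists_le_of_mixture [IsProbabilityMeasure μ]
    (h : IsSampling μ ℱ D Y p) (ν : Measure ℝ) [SFinite ν] {φ : ℝ → ℝ} (hφm : Measurable φ)
    (hφ : ∀ᵐ l ∂ν, 1 + p * (Real.exp l - 1) ≤ Real.exp (φ l))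
    {E : ℕ → Set Ω} (hE : ∀ t, MeasurableSet[ℱ t] (E t))
    (hν : ∀ t, ∀ ω ∈ E t, 1 ≤ ∫⁻ l, ENNReal.ofReal (tiltedExp D Y l (φ l) t ω) ∂ν) (T : ℕ) :
    μ {ω | ∃ t < T, ω ∈ E t} ≤ ν Set.univ := by
  have hF : ∀ t, MeasurableSet (firstEntry E t) := fun t =>
    (ℱ.le t _ (measurableSet_notEntered hE t)).inter (ℱ.le t _ (hE t))
  have hjoint : ∀ t, Measurable fun q : Ω × ℝ =>
      ENNReal.ofReal (tiltedExp D Y q.2 (φ q.2) t q.1) := fun t => by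
    have h1 := ((h.measurable_visitSum t).mono (ℱ.le t) le_rfl).comp
      (measurable_fst : Measurable (Prod.fst : Ω × ℝ → Ω))
    have h2 := ((h.measurable_visitCount t).mono (ℱ.le t) le_rfl).comp
      (measurable_fst : Measurable (Prod.fst : Ω × ℝ → Ω))
    have h3 := hφm.comp (measurable_snd : Measurable (Prod.snd : Ω × ℝ → ℝ))
    exact ENNReal.measurable_ofReal.comp (Real.measurable_exp.comp
      ((measurable_snd.mul h1).sub (h3.mul h2)))
  calc μ {ω | ∃ t < T, ω ∈ E t}
      ≤ μ (⋃ t ∈ Finset.range T, firstEntry E t) := measure_mono (iUnion_subset_firstEntry E T)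
    _ ≤ ∑ t ∈ Finset.range T, μ (firstEntry E t) := measure_biUnion_finset_le _ _
    _ = ∑ t ∈ Finset.range T, ∫⁻ _ω in firstEntry E t, 1 ∂μ := by simp
    _ ≤ ∑ t ∈ Finset.range T, ∫⁻ ω in firstEntry E t,
          ∫⁻ l, ENNReal.ofReal (tiltedExp D Y l (φ l) t ω) ∂ν ∂μ :=
        Finset.sum_le_sum fun t _ => setLIntegral_mono' (hF t) fun ω hω => hν t ω hω.2
    _ = ∑ t ∈ Finset.range T, ∫⁻ l, ∫⁻ ω in firstEntry E t,
          ENNReal.ofReal (tiltedExp D Y l (φ l) t ω) ∂μ ∂ν :=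
        Finset.sum_congr rfl fun t _ => lintegral_lintegral_swap (hjoint t).aemeasurable
    _ = ∫⁻ l, ∑ t ∈ Finset.range T, ∫⁻ ω in firstEntry E t,
          ENNReal.ofReal (tiltedExp D Y l (φ l) t ω) ∂μ ∂ν := by
        refine (lintegral_finsetSum _ fun t _ => ?_).symm
        exact (hjoint t).lintegral_prod_left'
    _ ≤ ∫⁻ _l, 1 ∂ν := by
        refine lintegral_mono_ae ?_
        filter_upwards [hφ] with l hl
        refine sum_setLIntegral_firstEntry_le
          (V := fun t ω => ENNReal.ofReal (tiltedExp D Y l (φ l) t ω)) ?_ ?_ hE T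
        · simp [tiltedExp, visitSum, visitCount]
        · exact fun t G hG => h.setLIntegral_tiltedExp_succ_le hl t hG
    _ = ν Set.univ := by simp

/-- The maximal inequality for one tilt, obtained from a multiple of a Dirac measure. -/
theorem IsSampling.measure_exists_le_exp [IsProbabilityMeasure μ]
    (h : IsSampling μ ℱ D Y p) {l φ : ℝ} (hφ : 1 + p * (Real.exp l - 1) ≤ Real.exp φ)
    (c : ℝ) (T : ℕ) :
    μ {ω | ∃ t < T, c ≤ l * visitSum D Y t ω - φ * visitCount D t ω} ≤
      ENNReal.ofReal (Real.exp (-c)) := by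
  have := h.measure_exists_le_of_mixture (ENNReal.ofReal (Real.exp (-c)) • Measure.dirac l)
    (φ := fun _ => φ) measurable_const
    (Measure.ae_smul_measure (by rw [ae_dirac_eq]; exact hφ) _)
    (E := fun t => {ω | c ≤ l * visitSum D Y t ω - φ * visitCount D t ω})
    (fun t => measurableSet_le measurable_const
      (((h.measurable_visitSum t).const_mul l).sub ((h.measurable_visitCount t).const_mul φ)))
    (fun t ω hω => ?_) T
  · simpa using this
  · rw [lintegral_smul_measure, lintegral_dirac, smul_eq_mul,
      ← ENNReal.ofReal_mul (Real.exp_pos _).le, tiltedExp, ← Real.exp_add, ENNReal.one_le_ofReal,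
      Real.one_le_exp_iff]
    have : c ≤ l * visitSum D Y t ω - φ * visitCount D t ω := hω
    linarith

end Sampling
/-! ### Deviations of the empirical frequencies in Poisson divergence -/

/-- The divergence between Poisson laws of means `z` and `p`. It is the Legendre transform of
`l ↦ p * (exp l - 1)`; for `z = 0` the formula gives the correct value `p`. For
`p = 0 < z` it is a junk value instead of `+∞`; `IsSampling.ae_visitSum_eq_zero` excludes this case. -/
noncomputable def poissonKL (z p : ℝ) : ℝ := z * Real.log (z / p) - z + p

lemma poissonKL_nonneg {z p : ℝ} (hz : 0 < z) (hp : 0 < p) : 0 ≤ poissonKL z p := by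
  have h1 := Real.one_sub_inv_le_log_of_pos (div_pos hz hp)
  have h2 := mul_le_mul_of_nonneg_left h1 hz.le
  have h3 : z * (1 - (z / p)⁻¹) = z - p := by field_simp
  rw [poissonKL]
  linarith

lemma poissonKL_self {p : ℝ} (hp : p ≠ 0) : poissonKL p p = 0 := by
  simp [poissonKL, div_self hp]

lemma continuous_poissonKL {p : ℝ} (hp : 0 < p) : Continuous fun z => poissonKL z p := by
  have : (fun z => poissonKL z p) = fun z => z * Real.log z - z * Real.log p - z + p := by
    funext z
    rcases eq_or_ne z 0 with rfl | hz
    · simp [poissonKL]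
    · rw [poissonKL, Real.log_div hz hp.ne']; ring
  rw [this]
  exact ((Real.continuous_mul_log.sub (continuous_id.mul continuous_const)).sub
    continuous_id).add continuous_const

/-- If `q` lies between `p` and `z`, it is closer to `p` than `z` is. This follows from the three-point
identity for the divergence, without computing derivatives. -/
lemma poissonKL_le_of_between {p q z : ℝ} (hp : 0 < p) (hq : 0 < q) (hz : 0 < z)
    (h : 0 ≤ (z - q) * Real.log (q / p)) : poissonKL q p ≤ poissonKL z p := by
  have h1 := poissonKL_nonneg hz hq
  have h2 : poissonKL z p = poissonKL z q + poissonKL q p + (z - q) * Real.log (q / p) := by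
    simp only [poissonKL]
    rw [Real.log_div hz.ne' hp.ne', Real.log_div hz.ne' hq.ne', Real.log_div hq.ne' hp.ne']
    ring
  linarith

/-- A single tilt detects all points above `p` whose divergence from `p` exceeds `w`: it is the optimal
tilt of the point at divergence exactly `w`. -/
lemma exists_tilt_above {p w : ℝ} (hp : 0 < p) (hw : 0 < w) :
    ∃ l : ℝ, ∀ q, p ≤ q → w < poissonKL q p → w ≤ l * q - p * (Real.exp l - 1) := by
  by_cases hex : ∃ q, p ≤ q ∧ w < poissonKL q p
  · obtain ⟨q₀, hq₀, hwq⟩ := hex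
    obtain ⟨z, hz, hzw⟩ := intermediate_value_Icc hq₀ (continuous_poissonKL hp).continuousOn
      ⟨(poissonKL_self hp.ne').trans_le hw.le, hwq.le⟩
    have hz0 : 0 < z := hp.trans_le hz.1
    have hl : 0 ≤ Real.log (z / p) := Real.log_nonneg ((one_le_div hp).2 hz.1)
    refine ⟨Real.log (z / p), fun q hq hwq => ?_⟩
    have hzq : z ≤ q := by
      by_contra! hlt
      have := poissonKL_le_of_between hp (hp.trans_le hq) hz0
        (mul_nonneg (sub_nonneg.2 hlt.le) (Real.log_nonneg ((one_le_div hp).2 hq)))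
      exact absurd hwq (not_lt.2 (this.trans_eq hzw))
    rw [Real.exp_log (div_pos hz0 hp), mul_sub, mul_div_cancel₀ _ hp.ne', ← hzw]
    simp only [poissonKL]
    nlinarith [mul_le_mul_of_nonneg_left hzq hl]
  -- No point is far enough, so any tilt will do.
  · push Not at hex
    exact ⟨0, fun q hq hwq => absurd hwq (not_lt.2 (hex q hq))⟩

/-- The counterpart of `exists_tilt_above` for points below `p`. -/
lemma exists_tilt_below {p w : ℝ} (hp : 0 < p) (hw : 0 < w) :
    ∃ l : ℝ, ∀ q, 0 ≤ q → q ≤ p → w < poissonKL q p → w ≤ l * q - p * (Real.exp l - 1) := by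
  by_cases hex : ∃ q, 0 ≤ q ∧ q ≤ p ∧ w < poissonKL q p
  · obtain ⟨q₀, hq0, hq₀, hwq⟩ := hex
    obtain ⟨z, hz, hzw⟩ := intermediate_value_Icc' hq₀ (continuous_poissonKL hp).continuousOn
      ⟨(poissonKL_self hp.ne').trans_le hw.le, hwq.le⟩
    -- The level `w` is reached strictly inside, since `q₀` has a larger divergence; so `log (z / p)` is
    -- not a junk value.
    have hz0 : 0 < z := by
      refine (hq0.trans hz.1).lt_of_ne fun h0 => ?_
      have : q₀ = z := le_antisymm hz.1 (h0 ▸ hq0)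
      rw [this] at hwq
      exact hwq.ne' hzw
    have hl : Real.log (z / p) ≤ 0 :=
      Real.log_nonpos (div_pos hz0 hp).le ((div_le_one hp).2 hz.2)
    refine ⟨Real.log (z / p), fun q hq0 hq hwq => ?_⟩
    have hzq : q ≤ z := by
      by_contra! hlt
      have hq' : 0 < q := hz0.trans hlt
      have := poissonKL_le_of_between hp hq' hz0
        (mul_nonneg_of_nonpos_of_nonpos (sub_nonpos.2 hlt.le)
          (Real.log_nonpos (div_pos hq' hp).le ((div_le_one hp).2 hq)))
      exact absurd hwq (not_lt.2 (this.trans_eq hzw))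
    rw [Real.exp_log (div_pos hz0 hp), mul_sub, mul_div_cancel₀ _ hp.ne', ← hzw]
    simp only [poissonKL]
    nlinarith [mul_le_mul_of_nonpos_left hzq hl]
  · push Not at hex
    exact ⟨0, fun q h0 hq hwq => absurd hwq (not_lt.2 (hex q h0 hq))⟩

lemma exists_geometric_slice {ρ n₀ x : ℝ} (hρ : 1 < ρ) (hn : 0 < n₀) (hx : n₀ ≤ x) {J : ℕ}
    (hJ : 1 ≤ J) (hxJ : x ≤ n₀ * ρ ^ J) :
    ∃ j ∈ Finset.range J, n₀ * ρ ^ j ≤ x ∧ x ≤ n₀ * ρ ^ j * ρ := by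
  obtain ⟨n, hn1, hn2⟩ := exists_nat_pow_near ((one_le_div hn).2 hx) hρ
  rw [le_div_iff₀' hn] at hn1
  rw [div_lt_iff₀' hn] at hn2
  by_cases hnJ : n < J
  · exact ⟨n, Finset.mem_range.2 hnJ, hn1, by rw [mul_assoc, ← pow_succ]; exact hn2.le⟩
  · refine ⟨J - 1, Finset.mem_range.2 (by omega), ?_, ?_⟩
    · refine le_trans ?_ hn1
      gcongr
      · exact hρ.le
      · omega
    · rw [mul_assoc, ← pow_succ, Nat.sub_add_cancel hJ]; exact hxJ

section Sampling

variable {Ω : Type*} {m : MeasurableSpace Ω} {μ : Measure Ω} {ℱ : Filtration ℕ m}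
  {D : ℕ → Set Ω} {Y : ℕ → Ω → ℝ} {p : ℝ}

/-- An outcome of conditional probability zero is almost surely never observed. -/
lemma IsSampling.ae_visitSum_eq_zero [IsProbabilityMeasure μ] (h : IsSampling μ ℱ D Y 0) :
    ∀ᵐ ω ∂μ, ∀ t, visitSum D Y t ω = 0 := by
  have hk : ∀ k, ∀ᵐ ω ∂μ, (D k).indicator (Y k) ω = 0 := fun k => by
    have hD := ℱ.le k _ (h.meas_visit k)
    have h1 := h.integral_mul_obs k
      (f := (D k).indicator fun _ => (1 : ℝ))
      ((measurable_const.indicator (h.meas_visit k)).stronglyMeasurable)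
      ((integrable_const 1).indicator hD) (fun ω hω => by simp [hω])
    have h2 : (fun ω => (D k).indicator (fun _ => (1 : ℝ)) ω * Y k ω) =
        (D k).indicator (Y k) := by
      funext ω
      by_cases hω : ω ∈ D k <;> simp [hω]
    rw [h2] at h1
    simp only [mul_zero, integral_zero] at h1
    refine (integral_eq_zero_iff_of_nonneg_ae ?_ ((h.integrable_obs k).indicator hD)).1 h1
    filter_upwards [h.obs_mem k] with ω hω
    by_cases hk : ω ∈ D k <;> simp [hk, hω.1]
  filter_upwards [ae_all_iff.2 hk] with ω hω t
  exact Finset.sum_eq_zero fun k _ => hω k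

lemma one_add_mul_le_exp_poisson (p l : ℝ) :
    1 + p * (Real.exp l - 1) ≤ Real.exp (p * (Real.exp l - 1)) := by
  linarith [Real.add_one_le_exp (p * (Real.exp l - 1))]

/-- Deviations while the number of observations stays in one slice `[n, n * ρ]`. The factor `2` counts
the two sides of `p`. -/
lemma IsSampling.measure_poissonKL_slice_le [IsProbabilityMeasure μ] (h : IsSampling μ ℱ D Y p)
    (hp : 0 < p) {ε n ρ : ℝ} (hε : 0 < ε) (hn : 0 < n) (hρ : 1 < ρ) (T : ℕ) :
    μ {ω | ∃ t < T, (n ≤ visitCount D t ω ∧ visitCount D t ω ≤ n * ρ) ∧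
      ε < visitCount D t ω * poissonKL (visitSum D Y t ω / visitCount D t ω) p} ≤
      2 * ENNReal.ofReal (Real.exp (-(ε / ρ))) := by
  -- On the slice, `N * kl > ε` forces `kl > ε / (n * ρ)`, and then the exponent is at least
  -- `n * (ε / (n * ρ)) = ε / ρ`.
  have hw : 0 < ε / (n * ρ) := by positivity
  obtain ⟨l₁, hl₁⟩ := exists_tilt_above hp hw
  obtain ⟨l₂, hl₂⟩ := exists_tilt_below hp hw
  have H₁ := h.measure_exists_le_exp (one_add_mul_le_exp_poisson p l₁) (ε / ρ) T
  have H₂ := h.measure_exists_le_exp (one_add_mul_le_exp_poisson p l₂) (ε / ρ) T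
  rw [two_mul]
  refine le_trans ?_ ((measure_union_le _ _).trans (add_le_add H₁ H₂))
  refine measure_mono_ae ?_
  filter_upwards [h.ae_visitSum_mem] with ω hω
  rintro ⟨t, ht, ⟨hn1, hn2⟩, hk⟩
  set N := visitCount D t ω with hN
  set q := visitSum D Y t ω / N with hq
  have hN0 : 0 < N := hn.trans_le hn1
  have hQ : visitSum D Y t ω = N * q := by rw [hq, mul_div_cancel₀ _ hN0.ne']
  have hkw : ε / (n * ρ) < poissonKL q p := by
    have h0 : ε / N < poissonKL q p := (div_lt_iff₀' hN0).2 hk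
    exact lt_of_le_of_lt (div_le_div_of_nonneg_left hε.le hN0 hn2) h0
  have fin : ∀ l, ε / (n * ρ) ≤ l * q - p * (Real.exp l - 1) →
      ε / ρ ≤ l * visitSum D Y t ω - p * (Real.exp l - 1) * N := fun l hl => by
    have h1 := mul_le_mul hn1 hl hw.le hN0.le
    have h2 : n * (ε / (n * ρ)) = ε / ρ := by field_simp
    rw [hQ]
    linarith
  rcases le_total p q with hpq | hpq
  · exact Or.inl ⟨t, ht, fin l₁ (hl₁ q hpq hkw)⟩
  · exact Or.inr ⟨t, ht, fin l₂ (hl₂ q (div_nonneg (hω t).1 hN0.le) hpq hkw)⟩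

lemma IsSampling.measure_poissonKL_le [IsProbabilityMeasure μ] (h : IsSampling μ ℱ D Y p)
    (hp : 0 ≤ p) {ε ρ : ℝ} (hε : 0 < ε) (hρ : 1 < ρ) {T J : ℕ} (hJ : 1 ≤ J) (hT : (T : ℝ) ≤ ρ ^ J) :
    μ {ω | ∃ t < T + 1, 1 ≤ visitCount D t ω ∧
      ε < visitCount D t ω * poissonKL (visitSum D Y t ω / visitCount D t ω) p} ≤
      J * (2 * ENNReal.ofReal (Real.exp (-(ε / ρ)))) := by
  rcases hp.eq_or_lt with rfl | hp
  · refine le_of_eq_of_le (measure_mono_null_ae ?_ measure_empty) zero_le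
    filter_upwards [h.ae_visitSum_eq_zero] with ω hω
    rintro ⟨t, ht, -, hk⟩
    simp only [hω t, poissonKL, zero_div, zero_mul, sub_zero, add_zero, mul_zero] at hk
    exact absurd hk (not_lt.2 hε.le)
  · have hsub : {ω | ∃ t < T + 1, 1 ≤ visitCount D t ω ∧
        ε < visitCount D t ω * poissonKL (visitSum D Y t ω / visitCount D t ω) p} ⊆
        ⋃ j ∈ Finset.range J, {ω | ∃ t < T + 1,
          (1 * ρ ^ j ≤ visitCount D t ω ∧ visitCount D t ω ≤ 1 * ρ ^ j * ρ) ∧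
          ε < visitCount D t ω * poissonKL (visitSum D Y t ω / visitCount D t ω) p} := by
      rintro ω ⟨t, ht, h1, hk⟩
      have hNT : visitCount D t ω ≤ 1 * ρ ^ J := by
        rw [one_mul]
        refine ((visitCount_le D t ω).trans ?_).trans hT
        exact_mod_cast Nat.lt_succ_iff.1 ht
      obtain ⟨j, hj, hj1⟩ := exists_geometric_slice hρ one_pos h1 hJ hNT
      exact Set.mem_biUnion hj ⟨t, ht, hj1, hk⟩
    refine (measure_mono hsub).trans ((measure_biUnion_finset_le _ _).trans ?_)
    refine (Finset.sum_le_sum fun j _ => h.measure_poissonKL_slice_le hp hε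
      (n := 1 * ρ ^ j) (by positivity) hρ (T + 1)).trans_eq ?_
    simp

end Sampling

/-- Two terms of the series of `-log (1 - 1 / ε)`; the gain of `2 / 5` over the usual bound
`1 / log (ε / (ε - 1)) ≤ ε` is needed in `transition_constant_bound`. -/
lemma sub_mul_log_div_sub_one_ge {ε : ℝ} (hε : 2 ≤ ε) :
    1 ≤ (ε - 2 / 5) * Real.log (ε / (ε - 1)) := by
  have h0 : 0 < ε := by linarith
  have hx : |1 / ε| < 1 := by
    rw [abs_of_pos (by positivity), div_lt_one h0]; linarith
  have h1 := sum_le_hasSum (Finset.range 2) (fun i _ => by positivity)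
    (Real.hasSum_pow_div_log_of_abs_lt_one hx)
  have h2 : Real.log (ε / (ε - 1)) = -Real.log (1 - 1 / ε) := by
    rw [← Real.log_inv]; congr 1
    have : ε - 1 ≠ 0 := by linarith
    field_simp
  rw [← h2] at h1
  norm_num [Finset.sum_range_succ] at h1
  refine le_trans ?_ (mul_le_mul_of_nonneg_left h1 (by linarith))
  have : (ε - 2 / 5) * (ε⁻¹ + (ε ^ 2)⁻¹ / 2) = 1 + (ε - 2) / (10 * ε ^ 2) := by
    field_simp; ring
  rw [this]
  have : 0 ≤ (ε - 2) / (10 * ε ^ 2) := div_nonneg (by linarith) (by positivity)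
  linarith

/-- The ratio `ε / (ε - 1)` makes each slice cost `exp (1 - ε)`. -/
lemma exists_slicing {ε : ℝ} (hε : 2 ≤ ε) {T : ℕ} (hT : 2 ≤ T) :
    ∃ ρ : ℝ, 1 < ρ ∧ ∃ J : ℕ, 1 ≤ J ∧ (T : ℝ) ≤ ρ ^ J ∧
      J * Real.exp (-(ε / ρ)) ≤ ((ε - 2 / 5) * Real.log T + 1) * Real.exp (1 - ε) := by
  have hT' : (1 : ℝ) < T := by exact_mod_cast hT
  have hlT := Real.log_pos hT'
  have h1 : 0 < ε - 1 := by linarith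
  have hρ : 1 < ε / (ε - 1) := by rw [lt_div_iff₀ h1]; linarith
  have hl := Real.log_pos hρ
  refine ⟨ε / (ε - 1), hρ, ⌈Real.log T / Real.log (ε / (ε - 1))⌉₊, ?_, ?_, ?_⟩
  · exact Nat.one_le_ceil_iff.2 (div_pos hlT hl)
  · have := Nat.le_ceil (Real.log T / Real.log (ε / (ε - 1)))
    rw [div_le_iff₀ hl, ← Real.log_pow] at this
    exact (Real.log_le_log_iff (by linarith) (by positivity)).1 this
  · have h2 : -(ε / (ε / (ε - 1))) = 1 - ε := by field_simp; ring
    rw [h2]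
    gcongr
    refine (Nat.ceil_lt_add_one (div_pos hlT hl).le).le.trans ?_
    gcongr
    rw [div_le_iff₀ hl]
    nlinarith [mul_le_mul_of_nonneg_left (sub_mul_log_div_sub_one_ge hε) hlT.le]

/-- The radius `ε = B + log u * (1 + 1 / u)`, with `u = B + 1 / τ`, makes the total cost of the slices
at most `τ * exp (1 - B)`. -/
lemma transition_constant_bound {B τ : ℝ} (hB : 2 ≤ B) (hτ : 0 < τ) :
    B ≤ B + Real.log (B + 1 / τ) * (1 + 1 / (B + 1 / τ)) ∧
    ((B + Real.log (B + 1 / τ) * (1 + 1 / (B + 1 / τ)) - 2 / 5) * τ + 1) *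
      Real.exp (1 - (B + Real.log (B + 1 / τ) * (1 + 1 / (B + 1 / τ)))) ≤
      τ * Real.exp (1 - B) := by
  set u := B + 1 / τ with hu
  have hu2 : 2 ≤ u := by have : 0 < 1 / τ := by positivity
                         linarith
  have hu0 : 0 < u := by linarith
  have hlog : 0 ≤ Real.log u := Real.log_nonneg (by linarith)
  -- `log u / u ≤ 1 / e`; this is absorbed by the gain of `2 / 5` in the number of slices.
  have hv : Real.log u / u ≤ 2 / 5 := by
    rw [div_le_iff₀ hu0]
    have h1 := Real.log_le_sub_one_of_pos (div_pos hu0 (Real.exp_pos 1))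
    rw [Real.log_div hu0.ne' (Real.exp_pos 1).ne', Real.log_exp] at h1
    have h2 : u / Real.exp 1 ≤ u / (5 / 2) := by
      gcongr
      linarith [Real.exp_one_gt_d9]
    linarith
  refine ⟨?_, ?_⟩
  · have : 0 ≤ Real.log u * (1 + 1 / u) := by positivity
    linarith
  · have e1 : Real.exp (1 - (B + Real.log u * (1 + 1 / u))) =
        Real.exp (1 - B) * (Real.exp (Real.log u * (1 + 1 / u)))⁻¹ := by
      rw [← Real.exp_neg, ← Real.exp_add]; congr 1; ring
    have e2 : u + Real.log u ≤ Real.exp (Real.log u * (1 + 1 / u)) := by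
      have : Real.log u * (1 + 1 / u) = Real.log u + Real.log u / u := by ring
      rw [this, Real.exp_add, Real.exp_log hu0]
      have h3 := mul_le_mul_of_nonneg_left (Real.add_one_le_exp (Real.log u / u)) hu0.le
      have h4 : u * (Real.log u / u + 1) = u + Real.log u := by field_simp; ring
      linarith
    have e3 : (B + Real.log u * (1 + 1 / u) - 2 / 5) * τ + 1 ≤
        τ * Real.exp (Real.log u * (1 + 1 / u)) := by
      have h5 : (B + Real.log u * (1 + 1 / u) - 2 / 5) * τ + 1 =
          τ * (u + Real.log u + (Real.log u / u - 2 / 5)) := by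
        rw [hu]; field_simp; ring
      rw [h5]
      gcongr
      linarith
    rw [e1]
    calc _ ≤ τ * Real.exp (Real.log u * (1 + 1 / u)) *
          (Real.exp (1 - B) * (Real.exp (Real.log u * (1 + 1 / u)))⁻¹) := by gcongr
      _ = τ * Real.exp (1 - B) := by field_simp

/-! ### Hoeffding deviations on the scale `√N`: small thresholds -/

/-- Hoeffding's lemma for a Bernoulli variable of mean `p`. -/
lemma one_add_mul_le_exp_hoeffding {p : ℝ} (hp : p ∈ Set.Icc (0 : ℝ) 1) (l : ℝ) :
    1 + p * (Real.exp l - 1) ≤ Real.exp (l * p + l ^ 2 / 8) := by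
  have h1p : 0 ≤ 1 - p := sub_nonneg.2 hp.2
  set ν : Measure ℝ := ENNReal.ofReal (1 - p) • Measure.dirac 0 + ENNReal.ofReal p •
    Measure.dirac 1 with hν
  have hprob : IsProbabilityMeasure ν := ⟨by
    simp only [hν, Measure.coe_add, Measure.coe_smul, Pi.add_apply, Pi.smul_apply, measure_univ,
      smul_eq_mul, mul_one]
    rw [← ENNReal.ofReal_add h1p hp.1]; simp⟩
  have hint : ∀ f : ℝ → ℝ, ∫ x, f x ∂ν = (1 - p) * f 0 + p * f 1 := fun f => by
    have hi : ∀ (c b : ℝ), Integrable f (ENNReal.ofReal c • Measure.dirac b) := fun c b =>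
      (integrable_dirac (by simp)).smul_measure ENNReal.ofReal_ne_top
    rw [hν, integral_add_measure (hi _ _) (hi _ _), integral_smul_measure, integral_smul_measure,
      integral_dirac, integral_dirac, ENNReal.toReal_ofReal h1p, ENNReal.toReal_ofReal hp.1]
    rfl
  have hb : ∀ᵐ x ∂ν, (fun x : ℝ => x) x ∈ Set.Icc (0 : ℝ) 1 := by
    rw [hν, ae_add_measure_iff]
    exact ⟨Measure.ae_smul_measure (by rw [ae_dirac_eq]; simp) _,
      Measure.ae_smul_measure (by rw [ae_dirac_eq]; simp) _⟩
  have h1 := (ProbabilityTheory.hasSubgaussianMGF_of_mem_Icc aemeasurable_id' hb).mgf_le l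
  simp only [ProbabilityTheory.mgf, hint] at h1
  norm_num at h1
  have h2 := mul_le_mul_of_nonneg_left h1 (Real.exp_pos (l * p)).le
  have e1 : Real.exp (l * (1 - p)) = Real.exp l * Real.exp (-(l * p)) := by
    rw [← Real.exp_add]; congr 1; ring
  have e2 : Real.exp (l * p) * Real.exp (-(l * p)) = 1 := by rw [← Real.exp_add]; simp
  rw [e1, ← Real.exp_add (l * p)] at h2
  calc 1 + p * (Real.exp l - 1) = Real.exp (l * p) *
        ((1 - p) * Real.exp (-(l * p)) + p * (Real.exp l * Real.exp (-(l * p)))) := by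
        linear_combination -(1 - p + p * Real.exp l) * e2
    _ ≤ _ := h2
    _ = _ := by ring_nf

section Sampling

variable {Ω : Type*} {m : MeasurableSpace Ω} {μ : Measure Ω} {ℱ : Filtration ℕ m}
  {D : ℕ → Set Ω} {Y : ℕ → Ω → ℝ} {p : ℝ}

lemma exists_nat_eq_visitCount (D : ℕ → Set Ω) (t : ℕ) (ω : Ω) :
    ∃ n : ℕ, visitCount D t ω = n := by
  classical
  refine ⟨∑ k ∈ Finset.range t, if ω ∈ D k then 1 else 0, ?_⟩
  simp [visitCount, Set.indicator_apply]

/-- Replacing `Y` by `1 - Y` exchanges upper and lower deviations. -/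
lemma IsSampling.compl [IsProbabilityMeasure μ] (h : IsSampling μ ℱ D Y p) :
    IsSampling μ ℱ D (fun k ω => 1 - Y k ω) (1 - p) where
  meas_visit := h.meas_visit
  meas_obs k := measurable_const.sub (h.meas_obs k)
  obs_mem k := by
    filter_upwards [h.obs_mem k] with ω hω
    exact ⟨sub_nonneg.2 hω.2, sub_le_self _ hω.1⟩
  mean k := by
    have h1 := condExp_sub (m := ℱ k) (integrable_const (1 : ℝ)) (h.integrable_obs k)
    rw [condExp_const (ℱ.le k)] at h1
    filter_upwards [h.mean k, h1] with ω hω h1 hD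
    refine h1.trans ?_
    simp [hω hD]

lemma visitSum_compl (D : ℕ → Set Ω) (Y : ℕ → Ω → ℝ) (t : ℕ) (ω : Ω) :
    visitSum D (fun k ω => 1 - Y k ω) t ω = visitCount D t ω - visitSum D Y t ω := by
  simp only [visitSum, visitCount, ← Finset.sum_sub_distrib]
  refine Finset.sum_congr rfl fun k _ => ?_
  by_cases hk : ω ∈ D k <;> simp [hk]

/-- A conditional mean outside `[0, 1]` is impossible, so such a pair is almost surely never visited. -/
lemma IsSampling.ae_visitCount_eq_zero [IsProbabilityMeasure μ] (h : IsSampling μ ℱ D Y p)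
    (hp : p ∉ Set.Icc (0 : ℝ) 1) : ∀ᵐ ω ∂μ, ∀ t, visitCount D t ω = 0 := by
  have hk : ∀ k, ∀ᵐ ω ∂μ, ω ∉ D k := fun k => by
    have h0 : 0 ≤ᵐ[μ] μ[Y k | ℱ k] := condExp_nonneg ((h.obs_mem k).mono fun ω hω => hω.1)
    have h1 : μ[Y k | ℱ k] ≤ᵐ[μ] μ[fun _ => (1 : ℝ) | ℱ k] :=
      condExp_mono (h.integrable_obs k) (integrable_const 1)
        ((h.obs_mem k).mono fun ω hω => hω.2)
    rw [condExp_const (ℱ.le k)] at h1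
    filter_upwards [h0, h1, h.mean k] with ω h0 h1 hm hD
    exact hp ⟨(hm hD) ▸ h0, (hm hD) ▸ h1⟩
  filter_upwards [ae_all_iff.2 hk] with ω hω t
  exact Finset.sum_eq_zero fun k _ => by simp [hω k]

/-- On the slice `[n, n * s ^ 2]` the tilt `8 * C / (√n * (1 + s))` gives the same exponent at both
ends, and a larger one in between. -/
lemma IsSampling.measure_hoeffding_slice_le [IsProbabilityMeasure μ] (h : IsSampling μ ℱ D Y p)
    (hp : p ∈ Set.Icc (0 : ℝ) 1) {C n s : ℝ} (hC : 0 < C) (hn : 0 < n) (hs : 1 < s) (T : ℕ) :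
    μ {ω | ∃ t < T, (n ≤ visitCount D t ω ∧ visitCount D t ω ≤ n * s ^ 2) ∧
      C * √(visitCount D t ω) < visitSum D Y t ω - p * visitCount D t ω} ≤
      ENNReal.ofReal (Real.exp (-(8 * C ^ 2 * s / (1 + s) ^ 2))) := by
  set r := √n with hr
  have hr0 : 0 < r := Real.sqrt_pos.2 hn
  set l := 8 * C / (r * (1 + s)) with hl
  have hl0 : 0 < l := by positivity
  refine (measure_mono ?_).trans
    (h.measure_exists_le_exp (one_add_mul_le_exp_hoeffding hp l) (8 * C ^ 2 * s / (1 + s) ^ 2) T)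
  rintro ω ⟨t, ht, ⟨hn1, hn2⟩, hd⟩
  refine ⟨t, ht, ?_⟩
  set N := visitCount D t ω
  obtain ⟨y, hy⟩ : ∃ y, √N = r * y := ⟨√N / r, by field_simp⟩
  have hN : N = (r * y) ^ 2 := by rw [← hy, Real.sq_sqrt (hn.le.trans hn1)]
  have hy1 : 1 ≤ y := by
    have := Real.sqrt_le_sqrt hn1
    rw [hy, ← hr] at this
    exact le_of_mul_le_mul_left (by linarith) hr0
  have hys : y ≤ s := by
    have := Real.sqrt_le_sqrt hn2
    rw [hy, Real.sqrt_mul hn.le, Real.sqrt_sq (by linarith), ← hr] at this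
    exact le_of_mul_le_mul_left this hr0
  have h1 := mul_le_mul_of_nonneg_left hd.le hl0.le
  have h2 : l * (C * √N) - l ^ 2 / 8 * N - 8 * C ^ 2 * s / (1 + s) ^ 2 =
      8 * C ^ 2 / (1 + s) ^ 2 * ((y - 1) * (s - y)) := by
    have : 1 + s ≠ 0 := by linarith
    rw [hy, hN, hl]
    field_simp
    ring
  have h3 : 0 ≤ 8 * C ^ 2 / (1 + s) ^ 2 * ((y - 1) * (s - y)) :=
    mul_nonneg (by positivity) (mul_nonneg (by linarith) (by linarith))
  linarith

lemma IsSampling.measure_hoeffding_slicing_le [IsProbabilityMeasure μ]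
    (h : IsSampling μ ℱ D Y p) (hp : p ∈ Set.Icc (0 : ℝ) 1) {C n s : ℝ} (hC : 0 < C) (hn : 0 < n)
    (hs : 1 < s) {T J : ℕ} (hJ : 1 ≤ J) (hT : (T : ℝ) ≤ n * (s ^ 2) ^ J) :
    μ {ω | ∃ t < T + 1, n ≤ visitCount D t ω ∧
      C * √(visitCount D t ω) < visitSum D Y t ω - p * visitCount D t ω} ≤
      ENNReal.ofReal (J * Real.exp (-(8 * C ^ 2 * s / (1 + s) ^ 2))) := by
  have hs2 : 1 < s ^ 2 := one_lt_pow₀ hs two_ne_zero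
  have hsub : {ω | ∃ t < T + 1, n ≤ visitCount D t ω ∧
        C * √(visitCount D t ω) < visitSum D Y t ω - p * visitCount D t ω} ⊆
      ⋃ j ∈ Finset.range J, {ω | ∃ t < T + 1, (n * (s ^ 2) ^ j ≤ visitCount D t ω ∧
        visitCount D t ω ≤ n * (s ^ 2) ^ j * s ^ 2) ∧
        C * √(visitCount D t ω) < visitSum D Y t ω - p * visitCount D t ω} := by
    rintro ω ⟨t, ht, h1, hk⟩
    have hNT : visitCount D t ω ≤ n * (s ^ 2) ^ J := by
      refine ((visitCount_le D t ω).trans ?_).trans hT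
      exact_mod_cast Nat.lt_succ_iff.1 ht
    obtain ⟨j, hj, hj1⟩ := exists_geometric_slice hs2 hn h1 hJ hNT
    exact Set.mem_biUnion hj ⟨t, ht, hj1, hk⟩
  refine (measure_mono hsub).trans ((measure_biUnion_finset_le _ _).trans ?_)
  refine (Finset.sum_le_sum fun j _ => h.measure_hoeffding_slice_le hp hC
    (n := n * (s ^ 2) ^ j) (by positivity) hs (T + 1)).trans_eq ?_
  rw [Finset.sum_const, Finset.card_range, nsmul_eq_mul,
    ENNReal.ofReal_mul (Nat.cast_nonneg _), ENNReal.ofReal_natCast]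

/-- A deviation of `C * √N` is at most `N`, hence needs more than `C ^ 2` observations. -/
lemma IsSampling.ae_sq_lt_visitCount (h : IsSampling μ ℱ D Y p)
    (hp : 0 ≤ p) {C : ℝ} (hC : 0 < C) :
    ∀ᵐ ω ∂μ, ∀ t, C * √(visitCount D t ω) < visitSum D Y t ω - p * visitCount D t ω →
      C ^ 2 < visitCount D t ω := by
  filter_upwards [h.ae_visitSum_mem] with ω hω t hd
  have h0 := visitCount_nonneg D t ω
  have h1 := mul_nonneg hp h0
  have h2 : C * √(visitCount D t ω) < √(visitCount D t ω) * √(visitCount D t ω) := by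
    rw [Real.mul_self_sqrt h0]
    linarith [(hω t).2]
  have h3 : C < √(visitCount D t ω) := lt_of_mul_lt_mul_right h2 (Real.sqrt_nonneg _)
  exact (Real.lt_sqrt hC.le).1 h3

/-- The number `J` of slices of ratio `ρ` needed to cover `[n, x]`. -/
lemma exists_nat_pow_bound {n ρ x : ℝ} (hn : 0 < n) (hρ : 1 < ρ) (hx : n ≤ x) :
    ∃ J : ℕ, 1 ≤ J ∧ x ≤ n * ρ ^ J ∧ J * Real.log ρ ≤ Real.log x - Real.log n + Real.log ρ := by
  obtain ⟨k, hk1, hk2⟩ := exists_nat_pow_near ((one_le_div hn).2 hx) hρ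
  refine ⟨k + 1, by omega, ?_, ?_⟩
  · exact ((div_lt_iff₀' hn).1 hk2).le
  · have := Real.log_le_log (by positivity) hk1
    rw [Real.log_pow, Real.log_div (hn.trans_le hx).ne' hn.ne'] at this
    push_cast
    linarith

/-- Slices `[4 ^ j, 4 ^ (j + 1)]` suffice when `C ^ 2 ≤ 1`. -/
lemma IsSampling.measure_hoeffding_le_of_sq_le_one [IsProbabilityMeasure μ]
    (h : IsSampling μ ℱ D Y p) (hp : p ∈ Set.Icc (0 : ℝ) 1) {C : ℝ} (hC : 0 < C)
    (hC1 : C ^ 2 ≤ 1) {T : ℕ} (hT : 2 ≤ T) :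
    μ {ω | ∃ t < T + 1, 1 ≤ visitCount D t ω ∧
      C * √(visitCount D t ω) < visitSum D Y t ω - p * visitCount D t ω} ≤
      ENNReal.ofReal (2 * Real.log T * Real.exp (-(1.99 * C ^ 2))) := by
  have hT2 : (2 : ℝ) ≤ T := by exact_mod_cast hT
  have hlog2 := Real.log_two_gt_d9
  have hlT : Real.log 2 ≤ Real.log T := Real.log_le_log (by norm_num) hT2
  have hl4 : Real.log (2 ^ 2 : ℝ) = 2 * Real.log 2 := by rw [Real.log_pow]; norm_num
  obtain ⟨J, hJ, hTJ, hJb⟩ : ∃ J : ℕ, 1 ≤ J ∧ (T : ℝ) ≤ 1 * (2 ^ 2) ^ J ∧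
      (J : ℝ) * 1.28 ≤ 2 * Real.log T := by
    -- For `T ≤ 4` one slice is enough, where the general count of slices would be too large.
    by_cases h4 : (T : ℝ) ≤ 4
    · refine ⟨1, le_rfl, by norm_num; exact_mod_cast h4, ?_⟩
      norm_num
      linarith
    · obtain ⟨J, hJ, hTJ, hJb⟩ := exists_nat_pow_bound (n := 1) (ρ := 2 ^ 2) (x := T) one_pos
        (by norm_num) (by linarith)
      refine ⟨J, hJ, hTJ, ?_⟩
      have h5 : Real.log (2 ^ 2 : ℝ) ≤ Real.log T :=
        Real.log_le_log (by norm_num) (by linarith)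
      rw [hl4] at h5 hJb
      rw [Real.log_one] at hJb
      have hJ0 : (0 : ℝ) ≤ J := Nat.cast_nonneg J
      nlinarith
  refine (h.measure_hoeffding_slicing_le hp hC one_pos one_lt_two hJ hTJ).trans
    (ENNReal.ofReal_le_ofReal ?_)
  have hx : Real.exp (1.99 * C ^ 2 - 8 * C ^ 2 * 2 / (1 + 2) ^ 2) ≤ 1.28 := by
    have h6 : 1.99 * C ^ 2 - 8 * C ^ 2 * 2 / (1 + 2) ^ 2 ≤ 0.2123 := by linarith
    refine (Real.exp_le_exp.2 h6).trans ?_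
    have h7 := Real.one_sub_le_exp_neg (0.2123 : ℝ)
    rw [Real.exp_neg] at h7
    have h8 := (le_inv_comm₀ (by norm_num) (Real.exp_pos _)).1 h7
    exact h8.trans (by norm_num)
  have e : Real.exp (-(8 * C ^ 2 * 2 / (1 + 2) ^ 2)) =
      Real.exp (1.99 * C ^ 2 - 8 * C ^ 2 * 2 / (1 + 2) ^ 2) * Real.exp (-(1.99 * C ^ 2)) := by
    rw [← Real.exp_add]; congr 1; ring
  rw [e, ← mul_assoc]
  refine mul_le_mul_of_nonneg_right ?_ (Real.exp_pos _).le
  exact (mul_le_mul_of_nonneg_left hx (Nat.cast_nonneg J)).trans hJb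

/-- When `1 ≤ C ^ 2` a deviation needs two observations, so slices of ratio `9 / 4` may start at `2`. -/
lemma IsSampling.measure_hoeffding_le_of_sq_le_four [IsProbabilityMeasure μ]
    (h : IsSampling μ ℱ D Y p) (hp : p ∈ Set.Icc (0 : ℝ) 1) {C : ℝ} (hC : 0 < C)
    (hC1 : 1 ≤ C ^ 2) (hC4 : C ^ 2 ≤ 4) {T : ℕ} (hT : 2 ≤ T) :
    μ {ω | ∃ t < T + 1, 1 ≤ visitCount D t ω ∧
      C * √(visitCount D t ω) < visitSum D Y t ω - p * visitCount D t ω} ≤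
      ENNReal.ofReal (2 * Real.log T * Real.exp (-(1.99 * C ^ 2))) := by
  have hT2 : (2 : ℝ) ≤ T := by exact_mod_cast hT
  have hlog2 := Real.log_two_gt_d9
  have hl : 0.8 ≤ Real.log ((3 / 2) ^ 2 : ℝ) := by
    rw [Real.le_log_iff_exp_le (by norm_num)]
    have h1 : Real.exp 0.8 ^ 5 = Real.exp 1 ^ 4 := by
      rw [← Real.exp_nat_mul, ← Real.exp_nat_mul]; norm_num
    have h2 : Real.exp 1 ^ 4 ≤ (2.7183 : ℝ) ^ 4 := by
      gcongr; linarith [Real.exp_one_lt_d9]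
    refine le_of_pow_le_pow_left₀ (n := 5) (by norm_num) (by norm_num) ?_
    rw [h1]
    exact h2.trans (by norm_num)
  obtain ⟨J, hJ, hTJ, hJb⟩ := exists_nat_pow_bound (n := 2) (ρ := (3 / 2) ^ 2) (x := T) two_pos
    (by norm_num) hT2
  have hsub : ∀ᵐ ω ∂μ, (∃ t < T + 1, 1 ≤ visitCount D t ω ∧
      C * √(visitCount D t ω) < visitSum D Y t ω - p * visitCount D t ω) →
      (∃ t < T + 1, 2 ≤ visitCount D t ω ∧
      C * √(visitCount D t ω) < visitSum D Y t ω - p * visitCount D t ω) := by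
    filter_upwards [h.ae_sq_lt_visitCount hp.1 hC] with ω hω
    rintro ⟨t, ht, h1, hd⟩
    refine ⟨t, ht, ?_, hd⟩
    have h2 := hC1.trans_lt (hω t hd)
    obtain ⟨n, hn⟩ := exists_nat_eq_visitCount D t ω
    rw [hn] at h2 ⊢
    have h3 : 1 < n := by exact_mod_cast h2
    exact_mod_cast h3
  refine (measure_mono_ae hsub).trans ((h.measure_hoeffding_slicing_le hp hC two_pos
    (s := 3 / 2) (by norm_num) hJ hTJ).trans (ENNReal.ofReal_le_ofReal ?_))
  have hx : Real.exp (1.99 * C ^ 2 - 8 * C ^ 2 * (3 / 2) / (1 + 3 / 2) ^ 2) ≤ 1.36 := by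
    have h6 : 1.99 * C ^ 2 - 8 * C ^ 2 * (3 / 2) / (1 + 3 / 2) ^ 2 ≤ 0.14 + 0.14 := by
      norm_num; linarith
    refine (Real.exp_le_exp.2 h6).trans ?_
    have h7 := Real.one_sub_le_exp_neg (0.14 : ℝ)
    rw [Real.exp_neg] at h7
    have h8 := (le_inv_comm₀ (by norm_num) (Real.exp_pos _)).1 h7
    rw [Real.exp_add]
    exact (mul_le_mul h8 h8 (Real.exp_pos _).le (by norm_num)).trans (by norm_num)
  have e : Real.exp (-(8 * C ^ 2 * (3 / 2) / (1 + 3 / 2) ^ 2)) =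
      Real.exp (1.99 * C ^ 2 - 8 * C ^ 2 * (3 / 2) / (1 + 3 / 2) ^ 2) *
        Real.exp (-(1.99 * C ^ 2)) := by
    rw [← Real.exp_add]; congr 1; ring
  rw [e, ← mul_assoc]
  refine mul_le_mul_of_nonneg_right ?_ (Real.exp_pos _).le
  refine (mul_le_mul_of_nonneg_left hx (Nat.cast_nonneg J)).trans ?_
  have hlT : Real.log 2 ≤ Real.log T := Real.log_le_log (by norm_num) hT2
  have hJ1 : (1 : ℝ) ≤ J := by exact_mod_cast hJ
  nlinarith [mul_nonneg (sub_nonneg.2 hJ1) (sub_nonneg.2 hl)]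

end Sampling

/-! ### Hoeffding deviations on the scale `√N`: mixture over the tilt -/

lemma cubic_le_exp_neg {x : ℝ} (hx : 0 ≤ x) :
    1 - x + x ^ 2 / 2 - x ^ 3 / 6 ≤ Real.exp (-x) := by
  -- Multiplied by `exp y`, the cubic has derivative `-(y ^ 3 / 6) * exp y ≤ 0`.
  have hd : ∀ y : ℝ, HasDerivAt
      (fun y : ℝ => (1 - y + y ^ 2 / 2 - y ^ 3 / 6) * Real.exp y) (-(y ^ 3 / 6) * Real.exp y) y := by
    intro y
    have h1 : HasDerivAt (fun y : ℝ => 1 - y + y ^ 2 / 2 - y ^ 3 / 6) (-1 + y - y ^ 2 / 2) y := by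
      have := ((((hasDerivAt_const y (1 : ℝ)).sub (hasDerivAt_id y)).add
        ((hasDerivAt_pow 2 y).div_const 2)).sub ((hasDerivAt_pow 3 y).div_const 6))
      refine this.congr_deriv ?_
      norm_num; ring
    exact (h1.mul (Real.hasDerivAt_exp y)).congr_deriv (by ring)
  have hanti : AntitoneOn (fun y : ℝ => (1 - y + y ^ 2 / 2 - y ^ 3 / 6) * Real.exp y)
      (Set.Ici 0) := by
    refine antitoneOn_of_deriv_nonpos (convex_Ici 0)
      (fun y _ => (hd y).continuousAt.continuousWithinAt)
      (fun y _ => (hd y).differentiableAt.differentiableWithinAt) fun y hy => ?_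
    rw [interior_Ici] at hy
    have hy0 : 0 < y := hy
    rw [(hd y).deriv, neg_mul]
    exact neg_nonpos.2 (by positivity)
  have h := hanti (Set.mem_Ici.2 le_rfl) (Set.mem_Ici.2 hx) hx
  simp only [Real.exp_zero] at h
  rw [Real.exp_neg, ← one_div, le_div_iff₀ (Real.exp_pos x)]
  linarith

/-- The integral over `[-6 / 5, 6 / 5]` of the Taylor polynomial `1 - x ^ 2 + x ^ 4 / 2 - x ^ 6 / 6` of
`exp (-x ^ 2)`; a lower bound for the mass of the Gaussian in that window. -/
noncomputable def gaussWindowMass : ℝ :=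
  12 / 5 * (1 - (6 / 5) ^ 2 / 3 + (6 / 5) ^ 4 / 10 - (6 / 5) ^ 6 / 42)

lemma integral_window {g a : ℝ} (hg : 0 < g) (ha : g * a = 6 / 5) :
    ∫ v in (-a)..a, (1 - v) * (1 - (g * v) ^ 2 + ((g * v) ^ 2) ^ 2 / 2 - ((g * v) ^ 2) ^ 3 / 6) =
      gaussWindowMass / g := by
  have hd : ∀ v : ℝ, HasDerivAt (fun v : ℝ =>
      (v - g ^ 2 * v ^ 3 / 3 + g ^ 4 * v ^ 5 / 10 - g ^ 6 * v ^ 7 / 42) -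
      (v ^ 2 / 2 - g ^ 2 * v ^ 4 / 4 + g ^ 4 * v ^ 6 / 12 - g ^ 6 * v ^ 8 / 48))
      ((1 - v) * (1 - (g * v) ^ 2 + ((g * v) ^ 2) ^ 2 / 2 - ((g * v) ^ 2) ^ 3 / 6)) v := by
    intro v
    have hp : ∀ (n : ℕ) (c k : ℝ), HasDerivAt (fun v : ℝ => c * v ^ n / k)
        (c * (n * v ^ (n - 1)) / k) v := fun n c k =>
      ((hasDerivAt_pow n v).const_mul c).div_const k
    have := ((((hasDerivAt_id v).sub (hp 3 (g ^ 2) 3)).add (hp 5 (g ^ 4) 10)).sub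
      (hp 7 (g ^ 6) 42)).sub (((((hasDerivAt_pow 2 v).div_const 2).sub (hp 4 (g ^ 2) 4)).add
      (hp 6 (g ^ 4) 12)).sub (hp 8 (g ^ 6) 48))
    refine this.congr_deriv ?_
    norm_num; ring
  rw [intervalIntegral.integral_eq_sub_of_hasDerivAt (fun v _ => hd v)
    (Continuous.intervalIntegrable (by fun_prop) _ _)]
  have h1 : a = 6 / 5 / g := by rw [← ha]; field_simp
  rw [h1, gaussWindowMass]
  field_simp
  ring

lemma gaussWindowMass_gt : 1.575 < gaussWindowMass := by
  norm_num [gaussWindowMass]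

lemma log_window_le {a : ℝ} (ha : 0 ≤ a) (ha2 : a ^ 2 ≤ 0.18) :
    Real.log ((1 + a) / (1 - a)) ≤ 2.44 * a := by
  have h1 : a < 1 := by nlinarith
  have h2 : 0 < (1 + a) / (1 - a) := div_pos (by linarith) (by linarith)
  have h3 : 0 ≤ Real.log ((1 + a) / (1 - a)) :=
    Real.log_nonneg ((one_le_div (by linarith)).2 (by linarith))
  have h4 := Real.self_le_sinh_iff.2 h3
  rw [Real.sinh_log h2, inv_div] at h4
  refine h4.trans ?_
  have h5 : ((1 + a) / (1 - a) - (1 - a) / (1 + a)) / 2 = 2 * a / (1 - a ^ 2) := by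
    have : 1 - a ≠ 0 := by linarith
    have : 1 + a ≠ 0 := by linarith
    have : 1 - a ^ 2 ≠ 0 := by nlinarith
    field_simp
    ring
  rw [h5, div_le_iff₀ (by linarith)]
  nlinarith [mul_le_mul_of_nonneg_left ha2 ha]

/-- The maximum, at `g = 10`, is `10 / √e < 6.1`. -/
lemma mul_exp_neg_sq_le (g : ℝ) : g * Real.exp (-(0.005 * g ^ 2)) ≤ 6.1 := by
  refine le_of_sq_le_sq ?_ (by norm_num)
  have h1 := Real.add_one_le_exp (0.01 * g ^ 2 - 1)
  have h2 : (g * Real.exp (-(0.005 * g ^ 2))) ^ 2 = g ^ 2 * Real.exp (-(0.01 * g ^ 2)) := by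
    rw [mul_pow, ← Real.exp_nat_mul]; congr 2; push_cast; ring
  have h3 : Real.exp (0.01 * g ^ 2 - 1) * Real.exp (-(0.01 * g ^ 2)) = (Real.exp 1)⁻¹ := by
    rw [← Real.exp_add, ← Real.exp_neg]; congr 1; ring
  have h4 : (Real.exp 1)⁻¹ ≤ 0.368 := by
    rw [inv_le_comm₀ (Real.exp_pos 1) (by norm_num)]
    refine le_trans (by norm_num) Real.exp_one_gt_d9.le
  have h5 := mul_le_mul_of_nonneg_right h1 (Real.exp_pos (-(0.01 * g ^ 2))).le
  rw [h2]
  linarith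

/-- The mass of the mixture with tilts in `[4 C (1 - a) / √T, 4 C (1 + a) / √4]`, where
`a = 6 / (5 g)` and `g ^ 2 = 2 * C ^ 2`, is within the required bound. The inequality
`g * exp (-0.005 * g ^ 2) ≤ 6.1 ≤ 4 * 1.575` handles the part linear in `log T`, and `log T ≥ log 4`
handles the window at the two ends. -/
lemma mixture_mass_le {g T : ℝ} (hg : 8 ≤ g ^ 2) (hg0 : 0 < g) (hT : 4 ≤ T) :
    g * Real.exp (-g ^ 2) / gaussWindowMass *
      (Real.log T / 2 - Real.log 2 + Real.log ((1 + 6 / (5 * g)) / (1 - 6 / (5 * g)))) ≤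
      2 * Real.log T * Real.exp (-(0.995 * g ^ 2)) := by
  have hI := gaussWindowMass_gt
  have hI0 : 0 < gaussWindowMass := by linarith
  have ha2 : (6 / (5 * g)) ^ 2 ≤ 0.18 := by
    rw [div_pow, mul_pow, div_le_iff₀ (by positivity)]
    linarith
  have hw := log_window_le (a := 6 / (5 * g)) (by positivity) ha2
  have hlog2 := Real.log_two_gt_d9
  have hlT : 2 * Real.log 2 ≤ Real.log T := by
    rw [← Real.log_rpow two_pos]
    exact Real.log_le_log (by positivity) (by norm_num; exact hT)
  have e : Real.exp (-g ^ 2) = Real.exp (-(0.005 * g ^ 2)) * Real.exp (-(0.995 * g ^ 2)) := by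
    rw [← Real.exp_add]; congr 1; ring
  set E := Real.exp (-(0.005 * g ^ 2)) with hE
  have hE0 : 0 < E := Real.exp_pos _
  have hE1 : E ≤ 1 := Real.exp_le_one_iff.2 (by nlinarith)
  have hgE := mul_exp_neg_sq_le g
  rw [← hE] at hgE
  have key : g * E * (Real.log T / 2 - Real.log 2 +
      Real.log ((1 + 6 / (5 * g)) / (1 - 6 / (5 * g)))) ≤ 2 * Real.log T * gaussWindowMass := by
    have h1 : g * E * (Real.log T / 2 - Real.log 2) ≤ 6.1 * (Real.log T / 2 - Real.log 2) :=
      mul_le_mul_of_nonneg_right hgE (by linarith)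
    have h2 : g * E * Real.log ((1 + 6 / (5 * g)) / (1 - 6 / (5 * g))) ≤ 2.928 := by
      refine (mul_le_mul_of_nonneg_left hw (by positivity)).trans ?_
      have : g * E * (2.44 * (6 / (5 * g))) = 2.928 * E := by field_simp; norm_num
      rw [this]; linarith
    have h3 : 2 * Real.log T * 1.575 ≤ 2 * Real.log T * gaussWindowMass :=
      mul_le_mul_of_nonneg_left hI.le (by linarith)
    rw [mul_add]
    linarith
  rw [e]
  calc _ = g * E * (Real.log T / 2 - Real.log 2 +
        Real.log ((1 + 6 / (5 * g)) / (1 - 6 / (5 * g)))) / gaussWindowMass *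
        Real.exp (-(0.995 * g ^ 2)) := by ring
    _ ≤ _ := by
      gcongr
      exact (div_le_iff₀ hI0).2 key

/-- If the exponent at tilt `l₀ * (1 + v)` is at least `g ^ 2 * (1 - v ^ 2)`, the mixture with density
`g * exp (-g ^ 2) / gaussWindowMass / l` has value at least `1` once its range contains the window
`|v| ≤ 6 / (5 * g)`. -/
lemma one_le_setLIntegral_window {g l₀ Δ W : ℝ} (hg : 8 ≤ g ^ 2) (hg0 : 0 < g) (hl₀ : 0 < l₀)
    (hΔ : ∀ l, 0 < l → g ^ 2 * (1 - (l / l₀ - 1) ^ 2) ≤ l * Δ - l ^ 2 / 8 * W)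
    {S : Set ℝ} (hS : Set.Icc (l₀ * (1 - 6 / (5 * g))) (l₀ * (1 + 6 / (5 * g))) ⊆ S) :
    1 ≤ ∫⁻ l in S, ENNReal.ofReal (g * Real.exp (-g ^ 2) / gaussWindowMass / l) *
      ENNReal.ofReal (Real.exp (l * Δ - l ^ 2 / 8 * W)) := by
  have hI0 : 0 < gaussWindowMass := by linarith [gaussWindowMass_gt]
  set a := 6 / (5 * g) with ha
  have ha0 : 0 < a := by positivity
  have hga : g * a = 6 / 5 := by rw [ha]; field_simp
  have ha2 : a ^ 2 ≤ 0.18 := by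
    rw [ha, div_pow, mul_pow, div_le_iff₀ (by positivity)]
    linarith
  have ha1 : a < 1 := by nlinarith
  -- `F v` bounds `exp (-(g * v) ^ 2) / (1 + v)` from below, through `1 / (1 + v) ≥ 1 - v`; the odd part
  -- of `1 - v` drops out of the integral.
  set F : ℝ → ℝ := fun v =>
    (1 - v) * (1 - (g * v) ^ 2 + ((g * v) ^ 2) ^ 2 / 2 - ((g * v) ^ 2) ^ 3 / 6) with hF
  set G : ℝ → ℝ := fun l => g / gaussWindowMass * (1 / l₀ * F (l / l₀ - 1)) with hG
  have hab : l₀ * (1 - a) ≤ l₀ * (1 + a) := by gcongr; linarith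
  have hv : ∀ l ∈ Set.Icc (l₀ * (1 - a)) (l₀ * (1 + a)), 0 < l ∧ |l / l₀ - 1| ≤ a := by
    intro l hl
    refine ⟨(mul_pos hl₀ (by linarith)).trans_le hl.1, abs_le.2 ⟨?_, ?_⟩⟩
    · have := (le_div_iff₀' hl₀).2 hl.1; linarith
    · have := (div_le_iff₀' hl₀).2 hl.2; linarith
  have hcont : Continuous G := by fun_prop
  have hnonneg : ∀ l ∈ Set.Icc (l₀ * (1 - a)) (l₀ * (1 + a)), 0 ≤ G l := by
    intro l hl
    obtain ⟨hl0, hva⟩ := hv l hl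
    set v := l / l₀ - 1
    have h1 : 0 ≤ 1 - v := by linarith [(abs_le.1 hva).2]
    have h2 : (g * v) ^ 2 ≤ 1.44 := by
      have : (g * v) ^ 2 = g ^ 2 * |v| ^ 2 := by rw [sq_abs]; ring
      rw [this]
      calc g ^ 2 * |v| ^ 2 ≤ g ^ 2 * a ^ 2 := by gcongr
        _ = (g * a) ^ 2 := by ring
        _ ≤ 1.44 := by rw [hga]; norm_num
    have h3 : 0 ≤ 1 - (g * v) ^ 2 + ((g * v) ^ 2) ^ 2 / 2 - ((g * v) ^ 2) ^ 3 / 6 := by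
      have h0 : 0 ≤ (g * v) ^ 2 := sq_nonneg _
      generalize (g * v) ^ 2 = x at h0 h2
      nlinarith [mul_nonneg h0 h0, mul_nonneg (mul_nonneg h0 h0) (sub_nonneg.2 h2),
        sq_nonneg (x - 1)]
    have : 0 ≤ F v := mul_nonneg h1 h3
    simp only [hG]
    positivity
  have hpt : ∀ l ∈ Set.Icc (l₀ * (1 - a)) (l₀ * (1 + a)), ENNReal.ofReal (G l) ≤
      ENNReal.ofReal (g * Real.exp (-g ^ 2) / gaussWindowMass / l) *
        ENNReal.ofReal (Real.exp (l * Δ - l ^ 2 / 8 * W)) := by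
    intro l hl
    obtain ⟨hl0, hva⟩ := hv l hl
    rw [← ENNReal.ofReal_mul (by positivity)]
    refine ENNReal.ofReal_le_ofReal ?_
    have h1 := Real.exp_le_exp.2 (hΔ l hl0)
    set v := l / l₀ - 1 with hvdef
    have hlv : l = l₀ * (1 + v) := by rw [hvdef]; field_simp; ring
    have hv1 : 0 < 1 + v := by linarith [(abs_le.1 hva).1]
    have hv2 : 0 ≤ 1 - v := by linarith [(abs_le.1 hva).2]
    have h2 := cubic_le_exp_neg (sq_nonneg (g * v))
    have h3 : F v ≤ 1 / (1 + v) * Real.exp (-(g * v) ^ 2) := by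
      refine (mul_le_mul_of_nonneg_left h2 hv2).trans
        (mul_le_mul_of_nonneg_right ?_ (Real.exp_pos _).le)
      rw [le_div_iff₀ hv1]
      nlinarith [sq_nonneg v]
    have h4 : Real.exp (-(g * v) ^ 2) = Real.exp (-g ^ 2) * Real.exp (g ^ 2 * (1 - v ^ 2)) := by
      rw [← Real.exp_add]; congr 1; ring
    calc G l = g / gaussWindowMass * (1 / l₀ * F v) := rfl
      _ ≤ g / gaussWindowMass * (1 / l₀ * (1 / (1 + v) * Real.exp (-(g * v) ^ 2))) := by gcongr
      _ = g * Real.exp (-g ^ 2) / gaussWindowMass / l * Real.exp (g ^ 2 * (1 - v ^ 2)) := by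
          rw [h4, hlv]; field_simp
      _ ≤ _ := by gcongr
  calc (1 : ENNReal) = ENNReal.ofReal (∫ l in Set.Icc (l₀ * (1 - a)) (l₀ * (1 + a)), G l) := by
        rw [integral_Icc_eq_integral_Ioc, ← intervalIntegral.integral_of_le hab]
        simp only [hG]
        rw [intervalIntegral.integral_const_mul, intervalIntegral.integral_const_mul,
          intervalIntegral.integral_comp_div_sub F hl₀.ne' 1,
          show l₀ * (1 - a) / l₀ - 1 = -a by field_simp; ring,
          show l₀ * (1 + a) / l₀ - 1 = a by field_simp; ring, hF, integral_window hg0 hga,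
          smul_eq_mul]
        rw [show g / gaussWindowMass * (1 / l₀ * (l₀ * (gaussWindowMass / g))) = 1 by field_simp,
          ENNReal.ofReal_one]
    _ = ∫⁻ l in Set.Icc (l₀ * (1 - a)) (l₀ * (1 + a)), ENNReal.ofReal (G l) :=
        ofReal_integral_eq_lintegral_ofReal (hcont.integrableOn_Icc)
          ((ae_restrict_iff' measurableSet_Icc).2 (ae_of_all _ hnonneg))
    _ ≤ ∫⁻ l in Set.Icc (l₀ * (1 - a)) (l₀ * (1 + a)),
        ENNReal.ofReal (g * Real.exp (-g ^ 2) / gaussWindowMass / l) *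
        ENNReal.ofReal (Real.exp (l * Δ - l ^ 2 / 8 * W)) :=
        setLIntegral_mono' measurableSet_Icc hpt
    _ ≤ _ := lintegral_mono_set hS

section Sampling

variable {Ω : Type*} {m : MeasurableSpace Ω} {μ : Measure Ω} {ℱ : Filtration ℕ m}
  {D : ℕ → Set Ω} {Y : ℕ → Ω → ℝ} {p : ℝ}

/-- For `C ^ 2 ≥ 4` the mixture over the tilts replaces the slices. The relevant tilt for `N`
observations is `4 * C / √N`, with `4 ≤ N ≤ T`. -/
lemma IsSampling.measure_hoeffding_le_of_four_le_sq [IsProbabilityMeasure μ]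
    (h : IsSampling μ ℱ D Y p) (hp : p ∈ Set.Icc (0 : ℝ) 1) {C : ℝ} (hC : 0 < C)
    (hC4 : 4 ≤ C ^ 2) (T : ℕ) :
    μ {ω | ∃ t < T + 1, 1 ≤ visitCount D t ω ∧
      C * √(visitCount D t ω) < visitSum D Y t ω - p * visitCount D t ω} ≤
      ENNReal.ofReal (2 * Real.log T * Real.exp (-(1.99 * C ^ 2))) := by
  set E : ℕ → Set Ω := fun t => {ω | 4 ≤ visitCount D t ω ∧ visitCount D t ω ≤ T ∧
      C * √(visitCount D t ω) < visitSum D Y t ω - p * visitCount D t ω} with hE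
  have hsub : ∀ᵐ ω ∂μ, (∃ t < T + 1, 1 ≤ visitCount D t ω ∧
      C * √(visitCount D t ω) < visitSum D Y t ω - p * visitCount D t ω) →
      ∃ t < T + 1, ω ∈ E t := by
    filter_upwards [h.ae_sq_lt_visitCount hp.1 hC] with ω hω
    rintro ⟨t, ht, h1, hd⟩
    refine ⟨t, ht, (hC4.trans_lt (hω t hd)).le, (visitCount_le D t ω).trans ?_, hd⟩
    exact_mod_cast Nat.lt_succ_iff.1 ht
  refine (measure_mono_ae hsub).trans ?_
  by_cases hT : (4 : ℝ) ≤ T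
  swap
  · refine le_of_eq_of_le (measure_mono_null ?_ measure_empty) zero_le
    rintro ω ⟨t, -, h1, h2, -⟩
    exact hT (h1.trans h2)
  have hEm : ∀ t, MeasurableSet[ℱ t] (E t) := fun t => by
    have hN := h.measurable_visitCount t
    have hQ := h.measurable_visitSum t
    exact (measurableSet_le measurable_const hN).inter ((measurableSet_le hN
      measurable_const).inter (measurableSet_lt ((Real.continuous_sqrt.measurable.comp
      hN).const_mul C) (hQ.sub (hN.const_mul p))))
  set g := √2 * C with hg
  have hg0 : 0 < g := by positivity
  have hg2 : g ^ 2 = 2 * C ^ 2 := by rw [hg, mul_pow, Real.sq_sqrt two_pos.le]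
  have hg8 : 8 ≤ g ^ 2 := by linarith
  set a := 6 / (5 * g) with ha
  have ha0 : 0 < a := by positivity
  have ha2 : a ^ 2 ≤ 0.18 := by
    rw [ha, div_pow, mul_pow, div_le_iff₀ (by positivity)]
    linarith
  have ha1 : a < 1 := by nlinarith
  have hI0 : 0 < gaussWindowMass := by linarith [gaussWindowMass_gt]
  set K := g * Real.exp (-g ^ 2) / gaussWindowMass with hK
  have hK0 : 0 < K := by positivity
  have hsT : 2 ≤ √(T : ℝ) := Real.le_sqrt_of_sq_le (by norm_num; exact_mod_cast hT)
  set l₁ := 4 * C / √T * (1 - a) with hl₁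
  set l₂ := 4 * C / 2 * (1 + a) with hl₂
  have hl₁0 : 0 < l₁ := mul_pos (by positivity) (by linarith)
  have hl₁₂ : l₁ ≤ l₂ := by
    rw [hl₁, hl₂]
    gcongr
    linarith
  set ν : Measure ℝ := (volume.restrict (Set.Icc l₁ l₂)).withDensity
    (fun l => ENNReal.ofReal (K / l)) with hν
  have hdm : Measurable fun l : ℝ => ENNReal.ofReal (K / l) :=
    ENNReal.measurable_ofReal.comp (measurable_const.div measurable_id)
  have hmain := h.measure_exists_le_of_mixture ν (φ := fun l => l * p + l ^ 2 / 8)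
    (by fun_prop) (ae_of_all _ (one_add_mul_le_exp_hoeffding hp)) hEm ?_ (T + 1)
  · refine hmain.trans ?_
    have hmass : ν Set.univ = ENNReal.ofReal (K * Real.log (l₂ / l₁)) := by
      rw [hν, withDensity_apply _ MeasurableSet.univ, Measure.restrict_univ,
        ← ofReal_integral_eq_lintegral_ofReal]
      · rw [integral_Icc_eq_integral_Ioc, ← intervalIntegral.integral_of_le hl₁₂]
        simp only [div_eq_mul_inv]
        rw [intervalIntegral.integral_const_mul, integral_inv, div_eq_mul_inv]
        rw [Set.uIcc_of_le hl₁₂]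
        exact fun h0 => absurd h0.1 (not_le.2 hl₁0)
      · refine ContinuousOn.integrableOn_Icc (continuousOn_const.div continuousOn_id ?_)
        exact fun l hl => (hl₁0.trans_le hl.1).ne'
      · refine (ae_restrict_iff' measurableSet_Icc).2 (ae_of_all _ fun l hl => ?_)
        exact div_nonneg hK0.le (hl₁0.trans_le hl.1).le
    rw [hmass]
    refine ENNReal.ofReal_le_ofReal ?_
    have hT0 : (0 : ℝ) < T := by linarith
    have hlog : Real.log (l₂ / l₁) =
        Real.log T / 2 - Real.log 2 + Real.log ((1 + a) / (1 - a)) := by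
      have : l₂ / l₁ = √T / 2 * ((1 + a) / (1 - a)) := by
        have : 1 - a ≠ 0 := by linarith
        rw [hl₁, hl₂]; field_simp
      rw [this, Real.log_mul (by positivity) (div_pos (by linarith) (by linarith)).ne',
        Real.log_div (by positivity) two_ne_zero, Real.log_sqrt hT0.le]
    rw [hlog]
    refine (mixture_mass_le hg8 hg0 hT).trans_eq ?_
    rw [hg2]
    congr 2
    ring
  · rintro t ω ⟨hN4, hNT, hd⟩
    set N := visitCount D t ω with hN
    set x := √N with hx
    have hN0 : 0 ≤ N := by linarith
    have hx2 : 2 ≤ x := Real.le_sqrt_of_sq_le (by norm_num; exact hN4)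
    have hxT : x ≤ √T := Real.sqrt_le_sqrt hNT
    have hx0 : 0 < x := by linarith
    have hNx : N = x ^ 2 := (Real.sq_sqrt hN0).symm
    have hwin := one_le_setLIntegral_window (l₀ := 4 * C / x)
      (Δ := visitSum D Y t ω - p * N) (W := N) hg8 hg0 (by positivity) ?_
      (S := Set.Icc l₁ l₂) (Set.Icc_subset_Icc ?_ ?_)
    · refine hwin.trans_eq ?_
      rw [hν, lintegral_withDensity_eq_lintegral_mul_non_measurable _ hdm
        (ae_of_all _ fun _ => ENNReal.ofReal_lt_top)]
      refine lintegral_congr fun l => ?_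
      simp only [Pi.mul_apply, tiltedExp, ← hN]
      congr 3
      ring
    · intro l hl
      have h1 := mul_le_mul_of_nonneg_left hd.le hl.le
      have h2 : g ^ 2 * (1 - (l / (4 * C / x) - 1) ^ 2) = l * (C * x) - l ^ 2 / 8 * x ^ 2 := by
        rw [hg2]; field_simp; ring
      rw [h2, ← hNx]
      linarith
    · rw [hl₁]
      gcongr
    · rw [hl₂]
      gcongr

/-- Upper deviations of the empirical mean beyond `C / √N`, uniformly over `N ≤ T`. -/
theorem IsSampling.measure_hoeffding_le [IsProbabilityMeasure μ]
    (h : IsSampling μ ℱ D Y p) {C : ℝ} (hC : 0 < C) {T : ℕ} (hT : 2 ≤ T) :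
    μ {ω | ∃ t < T + 1, 1 ≤ visitCount D t ω ∧
      C * √(visitCount D t ω) < visitSum D Y t ω - p * visitCount D t ω} ≤
      ENNReal.ofReal (2 * Real.log T * Real.exp (-(1.99 * C ^ 2))) := by
  by_cases hp : p ∈ Set.Icc (0 : ℝ) 1
  · rcases le_total (C ^ 2) 1 with h1 | h1
    · exact h.measure_hoeffding_le_of_sq_le_one hp hC h1 hT
    · rcases le_total (C ^ 2) 4 with h4 | h4
      · exact h.measure_hoeffding_le_of_sq_le_four hp hC h1 h4 hT
      · exact h.measure_hoeffding_le_of_four_le_sq hp hC h4 T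
  · refine le_of_eq_of_le (measure_mono_null_ae ?_ measure_empty) zero_le
    filter_upwards [h.ae_visitCount_eq_zero hp] with ω hω
    rintro ⟨t, -, h1, -⟩
    rw [hω t] at h1
    exact absurd h1 (by norm_num)

theorem IsSampling.measure_abs_hoeffding_le [IsProbabilityMeasure μ]
    (h : IsSampling μ ℱ D Y p) {C : ℝ} (hC : 0 < C) {T : ℕ} (hT : 2 ≤ T) :
    μ {ω | ∃ t < T + 1, 1 ≤ visitCount D t ω ∧
      C * √(visitCount D t ω) < |visitSum D Y t ω - p * visitCount D t ω|} ≤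
      2 * ENNReal.ofReal (2 * Real.log T * Real.exp (-(1.99 * C ^ 2))) := by
  rw [two_mul]
  refine le_trans (measure_mono ?_) ((measure_union_le _ _).trans
    (add_le_add (h.measure_hoeffding_le hC hT) (h.compl.measure_hoeffding_le hC hT)))
  rintro ω ⟨t, ht, h1, hd⟩
  rcases lt_abs.1 hd with hd | hd
  · exact Or.inl ⟨t, ht, h1, hd⟩
  · refine Or.inr ⟨t, ht, h1, ?_⟩
    rw [visitSum_compl]
    linarith

end Sampling

/-! ### Confidence sets along a trajectory -/

section Trajectory

variable {Ω X A : Type*} [Fintype X] {m : MeasurableSpace Ω}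
  {M : MDP X A} {μ : Measure Ω} {ℱ : Filtration ℕ m}
  {S : ℕ → Ω → X} {U : ℕ → Ω → A} {R : ℕ → Ω → ℝ}

lemma IsTrajectory.isSampling_reward (h : IsTrajectory M μ ℱ S U R) (x : X) (a : A) :
    IsSampling μ ℱ (fun k => {ω | S k ω = x ∧ U k ω = a}) R (M.reward x a) where
  meas_visit k := (h.state_meas k x).inter (h.action_meas k a)
  meas_obs := h.reward_meas
  obs_mem := h.reward_mem
  mean k := by
    filter_upwards [h.reward_mean k] with ω hω hD
    rw [hω, hD.1, hD.2]

lemma IsTrajectory.isSampling_trans (h : IsTrajectory M μ ℱ S U R) (x : X) (a : A) (y : X) :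
    IsSampling μ ℱ (fun k => {ω | S k ω = x ∧ U k ω = a})
      (fun k => Set.indicator {ω | S (k + 1) ω = y} (fun _ => (1 : ℝ))) (M.trans x a y) where
  meas_visit k := (h.state_meas k x).inter (h.action_meas k a)
  meas_obs k := measurable_const.indicator (h.state_meas (k + 1) y)
  obs_mem k := ae_of_all _ fun ω => by
    by_cases hω : S (k + 1) ω = y <;> simp [hω]
  mean k := by
    filter_upwards [h.state_law k y] with ω hω hD
    rw [hω, hD.1, hD.2]

end Trajectory

section Counts

variable {Ω X A : Type*} [DecidableEq X] [DecidableEq A]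

lemma visitCount_eq_visits (S : ℕ → Ω → X) (U : ℕ → Ω → A) (x : X) (a : A) (t : ℕ) (ω : Ω) :
    visitCount (fun k => {ω | S k ω = x ∧ U k ω = a}) t ω =
      visits (fun k => S k ω) (fun k => U k ω) t x a := by
  simp [visitCount, visits, Set.indicator_apply]

lemma visitSum_eq_visitsTo (S : ℕ → Ω → X) (U : ℕ → Ω → A) (x : X) (a : A) (y : X) (t : ℕ)
    (ω : Ω) :
    visitSum (fun k => {ω | S k ω = x ∧ U k ω = a})
      (fun k => Set.indicator {ω | S (k + 1) ω = y} (fun _ => (1 : ℝ))) t ω =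
      visitsTo (fun k => S k ω) (fun k => U k ω) t x a y := by
  simp only [visitSum, visitsTo, Set.indicator_apply, Finset.card_filter, Set.mem_ofPred_eq,
    Nat.cast_sum, Nat.cast_ite, Nat.cast_one, Nat.cast_zero, ← and_assoc, ite_and]

lemma visitSum_eq_sum_reward (S : ℕ → Ω → X) (U : ℕ → Ω → A) (R : ℕ → Ω → ℝ) (x : X) (a : A)
    (t : ℕ) (ω : Ω) :
    visitSum (fun k => {ω | S k ω = x ∧ U k ω = a}) R t ω =
      ∑ k ∈ Finset.range t, if S k ω = x ∧ U k ω = a then R k ω else 0 := by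
  simp [visitSum, Set.indicator_apply]

end Counts

lemma sum_visitsTo {X A : Type*} [Fintype X] [DecidableEq X] [DecidableEq A]
    (s : ℕ → X) (u : ℕ → A) (t : ℕ) (x : X) (a : A) :
    ∑ y, visitsTo s u t x a y = visits s u t x a := by
  simp only [visitsTo, visits, Finset.card_filter, ← and_assoc]
  rw [Finset.sum_comm]
  refine Finset.sum_congr rfl fun k _ => ?_
  by_cases hk : s k = x ∧ u k = a <;> simp [hk]

/-- The terms `- p i + q i` of the Poisson divergences cancel in the sum. -/
lemma klVec_le_of_poissonKL_le {X : Type*} [Fintype X] {p q : X → ℝ} {c : ℝ}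
    (hsum : ∑ i, p i = ∑ i, q i) (hac : ∀ i, q i = 0 → p i = 0)
    (hc : ∀ i, poissonKL (p i) (q i) ≤ c) :
    klVec p q ≤ ((Fintype.card X * c : ℝ) : EReal) := by
  have hne : ¬ ∃ i, p i ≠ 0 ∧ q i = 0 := by
    rintro ⟨i, h1, h2⟩
    exact h1 (hac i h2)
  rw [klVec, if_neg hne, EReal.coe_le_coe_iff]
  have h1 : ∑ i, p i * Real.log (p i / q i) = ∑ i, poissonKL (p i) (q i) := by
    simp only [poissonKL, Finset.sum_add_distrib, Finset.sum_sub_distrib, hsum, sub_add_cancel]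
  rw [h1]
  exact (Finset.sum_le_card_nsmul _ _ c fun i _ => hc i).trans_eq (by simp)

/-- The deterministic part: bounds on the visit counts and sums along a path place `M` in the
confidence set. Pairs that have not been visited impose no constraint. -/
lemma mem_confidenceSet_of_bounds {X A : Type*} [Fintype X] [DecidableEq X] [DecidableEq A]
    {M : MDP X A} {s : ℕ → X} {u : ℕ → A} {r : ℕ → ℝ} {t : ℕ} {ε CR : ℝ}
    (hR : ∀ x a, 1 ≤ (visits s u t x a : ℝ) →
      |(∑ k ∈ Finset.range t, if s k = x ∧ u k = a then r k else 0) -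
        M.reward x a * visits s u t x a| ≤ CR * √(visits s u t x a))
    (hac : ∀ x a y, M.trans x a y = 0 → (visitsTo s u t x a y : ℝ) = 0)
    (hP : ∀ x a y, 1 ≤ (visits s u t x a : ℝ) → (visits s u t x a : ℝ) *
      poissonKL ((visitsTo s u t x a y : ℝ) / visits s u t x a) (M.trans x a y) ≤ ε) :
    M ∈ confidenceSet (Fintype.card X * ε) CR s u r t := by
  intro x a
  rcases Nat.eq_zero_or_pos (visits s u t x a) with h0 | hpos
  · simp [radiusR, radiusP, h0]
  have h1 : (1 : ℝ) ≤ visits s u t x a := by exact_mod_cast hpos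
  have hN : (0 : ℝ) < visits s u t x a := by linarith
  rw [radiusR, radiusP, if_neg hpos.ne', if_neg hpos.ne', EReal.coe_le_coe_iff]
  refine ⟨?_, ?_⟩
  · have h2 := hR x a h1
    rw [estReward, max_eq_left h1]
    set N := (visits s u t x a : ℝ)
    have h3 : ∀ Q ρ : ℝ, Q / N - ρ = (Q - ρ * N) / N := fun Q ρ => by field_simp
    rw [h3, abs_div, abs_of_pos hN, div_le_div_iff₀ hN (Real.sqrt_pos.2 hN)]
    calc _ ≤ CR * √N * √N := by gcongr
      _ = CR * N := by rw [mul_assoc, Real.mul_self_sqrt hN.le]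
  · rw [mul_div_assoc]
    refine klVec_le_of_poissonKL_le ?_ (fun y hy => ?_) fun y => ?_
    · simp only [estTrans, max_eq_left h1]
      rw [← Finset.sum_div, M.trans_sum, ← Nat.cast_sum, sum_visitsTo, div_self hN.ne']
    · rw [estTrans, hac x a y hy, zero_div]
    · rw [estTrans, max_eq_left h1, le_div_iff₀' hN]
      exact hP x a y h1

lemma exp_one_le_four_mul_log_two : Real.exp 1 ≤ 4 * Real.log 2 := by
  linarith [Real.exp_one_lt_d9, Real.log_two_gt_d9]

lemma constB_spec {nX nA T : ℕ} {δ : ℝ} (hX : 1 ≤ nX) (hA : 1 ≤ nA) (hT : 2 ≤ T) (hδ : 0 < δ)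
    (hδ' : δ < 1 / 2) :
    2 ≤ constB nX nA T δ ∧
      Real.log T * Real.exp (1 - constB nX nA T δ) = δ / (2 * nX ^ 2 * nA) := by
  have hX' : (1 : ℝ) ≤ nX := by exact_mod_cast hX
  have hA' : (1 : ℝ) ≤ nA := by exact_mod_cast hA
  have hlT : Real.log 2 ≤ Real.log T := Real.log_le_log two_pos (by exact_mod_cast hT)
  have hlog2 : 0 < Real.log 2 := Real.log_pos one_lt_two
  have hτ : 0 < Real.log T := hlog2.trans_le hlT
  have hpos : 0 < 2 * Real.exp 1 * (nX : ℝ) ^ 2 * nA * Real.log T / δ := by positivity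
  constructor
  · rw [constB, Real.le_log_iff_exp_le hpos, le_div_iff₀ hδ]
    have h1 : Real.exp 2 = Real.exp 1 * Real.exp 1 := by rw [← Real.exp_add]; norm_num
    have h2 : (1 : ℝ) ≤ (nX : ℝ) ^ 2 * nA :=
      one_le_mul_of_one_le_of_one_le (one_le_pow₀ hX') hA'
    have h3 : Real.log 2 ≤ (nX : ℝ) ^ 2 * nA * Real.log T := by nlinarith
    have h4 : Real.exp 1 * δ ≤ 2 * ((nX : ℝ) ^ 2 * nA * Real.log T) := by
      nlinarith [exp_one_le_four_mul_log_two, Real.exp_pos 1]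
    have := mul_le_mul_of_nonneg_left h4 (Real.exp_pos 1).le
    rw [h1]
    linarith
  · rw [constB, Real.exp_sub, Real.exp_log hpos]
    field_simp

lemma constR_spec {nX nA T : ℕ} {δ : ℝ} (hX : 1 ≤ nX) (hA : 1 ≤ nA) (hT : 2 ≤ T) (hδ : 0 < δ)
    (hδ' : δ < 1 / 2) :
    0 < constR nX nA T δ ∧
      2 * Real.log T * Real.exp (-(1.99 * constR nX nA T δ ^ 2)) = δ / (2 * nX * nA) := by
  have hX' : (1 : ℝ) ≤ nX := by exact_mod_cast hX
  have hA' : (1 : ℝ) ≤ nA := by exact_mod_cast hA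
  have hlT : Real.log 2 ≤ Real.log T := Real.log_le_log two_pos (by exact_mod_cast hT)
  have hlog2 := Real.log_two_gt_d9
  have hτ : 0 < Real.log T := by linarith
  have hpos : 0 < 4 * (nX : ℝ) * nA * Real.log T / δ := by positivity
  have hL : 0 < Real.log (4 * (nX : ℝ) * nA * Real.log T / δ) := by
    refine Real.log_pos ?_
    rw [one_lt_div hδ]
    have h2 : (1 : ℝ) ≤ (nX : ℝ) * nA := one_le_mul_of_one_le_of_one_le hX' hA'
    nlinarith
  refine ⟨Real.sqrt_pos.2 (by positivity), ?_⟩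
  rw [constR, Real.sq_sqrt (by positivity), mul_div_cancel₀ _ (by norm_num), Real.exp_neg,
    Real.exp_log hpos]
  field_simp
  norm_num

section Union

variable {Ω X A : Type*} [Fintype X] [DecidableEq X] [Fintype A] [DecidableEq A]
  {m : MeasurableSpace Ω} {M : MDP X A} {μ : Measure Ω} {ℱ : Filtration ℕ m}
  {S : ℕ → Ω → X} {U : ℕ → Ω → A} {R : ℕ → Ω → ℝ}

lemma measure_exists_le_card_mul {ι : Type*} [Fintype ι] {μ : Measure Ω} (E : ι → Set Ω)
    {c : ℝ} (h : ∀ i, μ (E i) ≤ ENNReal.ofReal c) :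
    μ {ω | ∃ i, ω ∈ E i} ≤ ENNReal.ofReal (Fintype.card ι * c) := by
  have e : {ω | ∃ i, ω ∈ E i} = ⋃ i, E i := by ext; simp
  rw [e, ENNReal.ofReal_mul (Nat.cast_nonneg _), ENNReal.ofReal_natCast]
  exact (measure_iUnion_fintype_le μ E).trans
    ((Finset.sum_le_card_nsmul _ _ _ fun i _ => h i).trans_eq (by simp))

/-- The empirical rewards leave their confidence intervals with probability at most `δ`. -/
lemma IsTrajectory.measure_reward_failure_le [IsProbabilityMeasure μ] [Nonempty X] [Nonempty A]
    (h : IsTrajectory M μ ℱ S U R) {T : ℕ} (hT : 2 ≤ T) {δ : ℝ} (hδ : 0 < δ) (hδ' : δ < 1 / 2) :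
    μ {ω | ∃ i : X × A, ∃ t < T + 1,
      1 ≤ (visits (fun k => S k ω) (fun k => U k ω) t i.1 i.2 : ℝ) ∧
      constR (Fintype.card X) (Fintype.card A) T δ *
        √(visits (fun k => S k ω) (fun k => U k ω) t i.1 i.2 : ℝ) <
      |(∑ k ∈ Finset.range t, if S k ω = i.1 ∧ U k ω = i.2 then R k ω else 0) -
        M.reward i.1 i.2 * visits (fun k => S k ω) (fun k => U k ω) t i.1 i.2|} ≤
      ENNReal.ofReal δ := by
  obtain ⟨hC, hb⟩ := constR_spec (Fintype.card_pos (α := X)) (Fintype.card_pos (α := A)) hT hδ hδ'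
  refine (measure_exists_le_card_mul (c := 2 * (δ / (2 * Fintype.card X * Fintype.card A)))
    _ fun i => ?_).trans_eq ?_
  · have := (h.isSampling_reward i.1 i.2).measure_abs_hoeffding_le hC hT
    simp only [visitCount_eq_visits, visitSum_eq_sum_reward] at this
    rw [hb] at this
    rw [ENNReal.ofReal_mul two_pos.le, ENNReal.ofReal_ofNat]
    exact this
  · congr 1
    rw [Fintype.card_prod]
    push_cast
    field_simp

/-- With `ε = C_P / |X|`, some coordinate of some empirical transition law deviates by more than
`ε / N` in Poisson divergence with probability at most `δ`. -/
lemma IsTrajectory.exists_measure_trans_failure_le [IsProbabilityMeasure μ] [Nonempty X]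
    [Nonempty A] (h : IsTrajectory M μ ℱ S U R) {T : ℕ} (hT : 2 ≤ T) {δ : ℝ} (hδ : 0 < δ)
    (hδ' : δ < 1 / 2) :
    ∃ ε : ℝ, constP (Fintype.card X) (Fintype.card A) T δ = Fintype.card X * ε ∧
    μ {ω | ∃ i : X × A × X, ∃ t < T + 1,
      1 ≤ (visits (fun k => S k ω) (fun k => U k ω) t i.1 i.2.1 : ℝ) ∧
      ε < visits (fun k => S k ω) (fun k => U k ω) t i.1 i.2.1 *
        poissonKL ((visitsTo (fun k => S k ω) (fun k => U k ω) t i.1 i.2.1 i.2.2 : ℝ) /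
          visits (fun k => S k ω) (fun k => U k ω) t i.1 i.2.1) (M.trans i.1 i.2.1 i.2.2)} ≤
      ENNReal.ofReal δ := by
  have hX : (0 : ℝ) < Fintype.card X := by exact_mod_cast Fintype.card_pos (α := X)
  have hA : (0 : ℝ) < Fintype.card A := by exact_mod_cast Fintype.card_pos (α := A)
  obtain ⟨hB, hb⟩ := constB_spec (Fintype.card_pos (α := X)) (Fintype.card_pos (α := A)) hT hδ hδ'
  have hτ : 0 < Real.log T := Real.log_pos (by exact_mod_cast hT)
  obtain ⟨hε, hbound⟩ := transition_constant_bound hB hτ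
  refine ⟨_, rfl, ?_⟩
  generalize constB (Fintype.card X) (Fintype.card A) T δ + _ = ε at hε hbound ⊢
  obtain ⟨ρ, hρ, J, hJ, hTJ, hJρ⟩ := exists_slicing (hB.trans hε) hT
  refine (measure_exists_le_card_mul
    (c := 2 * (δ / (2 * Fintype.card X ^ 2 * Fintype.card A))) _ fun i => ?_).trans_eq ?_
  · have := (h.isSampling_trans i.1 i.2.1 i.2.2).measure_poissonKL_le (M.trans_nonneg _ _ _)
      (two_pos.trans_le (hB.trans hε)) hρ hJ hTJ
    simp only [visitCount_eq_visits, visitSum_eq_visitsTo] at this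
    refine this.trans ?_
    rw [← ENNReal.ofReal_ofNat 2, ← ENNReal.ofReal_mul two_pos.le, ← ENNReal.ofReal_natCast,
      ← ENNReal.ofReal_mul (Nat.cast_nonneg J)]
    refine ENNReal.ofReal_le_ofReal ?_
    linarith
  · congr 1
    rw [Fintype.card_prod, Fintype.card_prod]
    push_cast
    field_simp

end Union
end KLUCRL

theorem proposition1 {Ω X A : Type*} [Fintype X] [DecidableEq X] [Fintype A] [DecidableEq A]
    {m : MeasurableSpace Ω} (μ : Measure Ω) [IsProbabilityMeasure μ]
    (M : KLUCRL.MDP X A) (ℱ : Filtration ℕ m)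
    (S : ℕ → Ω → X) (U : ℕ → Ω → A) (R : ℕ → Ω → ℝ)
    (h : KLUCRL.IsTrajectory M μ ℱ S U R)
    (T : ℕ) (hT : 2 ≤ T) (δ : ℝ) (hδ : 0 < δ) :
    1 - 2 * δ ≤ μ.real {ω | ∀ t ≤ T,
      M ∈ KLUCRL.confidenceSet
        (KLUCRL.constP (Fintype.card X) (Fintype.card A) T δ)
        (KLUCRL.constR (Fintype.card X) (Fintype.card A) T δ)
        (fun k => S k ω) (fun k => U k ω) (fun k => R k ω) t} := by
  -- For `δ ≥ 1 / 2` the bound is nonpositive, and the constants may be junk values.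
  rcases le_or_gt (1 / 2) δ with hδ' | hδ'
  · exact le_trans (by linarith) measureReal_nonneg
  obtain ⟨ω₀⟩ : Nonempty Ω := nonempty_of_isProbabilityMeasure μ
  have : Nonempty X := ⟨S 0 ω₀⟩
  have : Nonempty A := ⟨U 0 ω₀⟩
  have hR := h.measure_reward_failure_le hT hδ hδ'
  obtain ⟨ε, hε, hP⟩ := h.exists_measure_trans_failure_le hT hδ hδ'
  rw [hε]
  have hac : ∀ᵐ ω ∂μ, ∀ x a y, M.trans x a y = 0 → ∀ t,
      (KLUCRL.visitsTo (fun k => S k ω) (fun k => U k ω) t x a y : ℝ) = 0 := by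
    refine ae_all_iff.2 fun x => ae_all_iff.2 fun a => ae_all_iff.2 fun y => ?_
    by_cases hp : M.trans x a y = 0
    · filter_upwards [(hp ▸ h.isSampling_trans x a y).ae_visitSum_eq_zero] with ω hω _ t
      rw [← KLUCRL.visitSum_eq_visitsTo]
      exact hω t
    · exact ae_of_all _ fun ω h0 => absurd h0 hp
  have hunion := (measure_union_le _ _).trans (add_le_add (le_refl (μ {ω | ∀ t ≤ T,
      M ∈ KLUCRL.confidenceSet (Fintype.card X * ε)
        (KLUCRL.constR (Fintype.card X) (Fintype.card A) T δ)
        (fun k => S k ω) (fun k => U k ω) (fun k => R k ω) t}))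
    ((measure_union_le _ _).trans (add_le_add hR hP)))
  have htot := (measure_mono_ae (s := Set.univ) (by
    filter_upwards [hac] with ω hω _
    by_contra hbad
    obtain ⟨hG, hF⟩ := not_or.1 hbad
    obtain ⟨hFR, hFP⟩ := not_or.1 hF
    exact hG fun t ht => KLUCRL.mem_confidenceSet_of_bounds
      (fun x a h1 => not_lt.1 fun hlt => hFR ⟨(x, a), t, Nat.lt_succ_iff.2 ht, h1, hlt⟩)
      (fun x a y h0 => hω x a y h0 t)
      (fun x a y h1 => not_lt.1 fun hlt =>
        hFP ⟨(x, a, y), t, Nat.lt_succ_iff.2 ht, h1, hlt⟩))).trans hunion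
  rw [measure_univ] at htot
  rw [← ENNReal.ofReal_add hδ.le hδ.le, ← ofReal_measureReal,
    ← ENNReal.ofReal_add measureReal_nonneg (by linarith), ENNReal.one_le_ofReal] at htot
  linarith
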